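/- **Setting.** Let $X$ be a complex manifold of dimension $n\ge 1$ (compact or not) with a Kähler metric $g$. In holomorphic coordinates write $\omega=\frac{\sqrt{-1}}{2}g_{\bar kj}\,dz^j\wedge d\bar z^k$, with $g_{\bar kj}=g(\partial_{z^j},\partial_{\bar z^k})$, and let $(g^{j\bar k})$ be the inverse matrix. Let $L\to X$ be a holomorphic line bundle. For a Hermitian metric $h$ of $L$ let $F_{\bar kj}=-\partial_j\partial_{\bar k}\log h$ and $F=\frac12F_{\bar kj}dz^j\wedge d\bar z^k$. Put $\zeta=(\omega-F)^n/\omega^n$, $d\mu(h)=|\zeta|\,\omega^n/n!$ and $\theta=\sum_i\arctan\lambda_i$, where $\lambda_1,\dots,\lambda_n$ are the eigenvalues of $(g^{j\bar k}F_{\bar k\ell})$. Let $T\in(0,\infty]$ and let $h=\{h_t\}_{t\in[0,T)}$ be a line bundle mean curvature flow of $L$: a smooth family of Hermitian metrics $h_t=e^{-u(t)}h_0$ such that $\frac{d}{dt}u=\theta(h_t)-\hat\theta$ for some constant $\hat\theta\in\mathbb R$. Let $U\subset X$ be open. Assume that $(X,g)$ is semi-flat on $U$: there are $r,r'>0$ and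 a diffeomorphism $\varphi:B(r)\times B(r')\to U$, where $B(\cdot)$ denotes open balls in $\mathbb R^n$ centered at $0$, with coordinates $x$ on $B(r)$ and $y$ on $B(r')$, which is biholomorphic for $z=x+\sqrt{-1}y$ and satisfies $g_{\bar ij}=g_{\bar ji}$ and $\partial g_{\bar ij}/\partial y^k=0$ for all $i,j,k$. Assume also that there is a nonvanishing holomorphic section $e$ of $L$ over $U$ for which every $h_t$ is graphical: $\partial\log h_t(\bar e,e)/\partial y^k=0$ on $U$ for all $k$. Put $\phi(\cdot,t)=-\log h_t(\bar e,e)$. Let $\lambda^2$ be the infimum over $U$ of the lowest eigenvalue of $(g_{\bar ij})$, with $\lambda\ge 0$, and assume $\lambda>0$. Let $\tilde f:\mathbb R\to[0,1]$ be a smooth function which equals $1$ on $(-\infty,1]$, equals $0$ on $[2,\infty)$, is strictly decreasing on $[1,2]$, and has bounded $|\tilde f'|+|\tilde f''|$. **Gaussian density.** Put $U_{r/4}=\varphi(B(r/4)\times B(r'))$. Let $Q=(p,T')\in U_{r/4}\times(0,T)$ and let $x_0\in B(r/4)$ be the $x$-component of $\varphi^{-1}(p)$. Put $$\tilde\phi(x,t)=\phi(x,t)-\Big(\phi(x_0,T')+\sum_i\frac{\partial\phi}{\partial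 x^i}(x_0,T')\,(x^i-x_0^i)\Big),\qquad \tilde h_t=e^{-\tilde\phi(t)}\,\bar e^*\otimes e^*,$$ and let $|\mathcal P(t)|$ be the norm of the position section $2(x^k-x_0^k)\frac{\partial}{\partial z^k}\oplus\frac12\frac{\partial\tilde\phi(t)}{\partial x^k}d\bar z^k$ of $\tilde h_t$, that is, $$|\mathcal P(t)|^2=4g_{\bar pq}(x^p-x_0^p)(x^q-x_0^q)+\tfrac14\,g^{p\bar q}\frac{\partial\tilde\phi(t)}{\partial x^p}\frac{\partial\tilde\phi(t)}{\partial x^q}.$$ For $0\le t<T'$ define $$\bar\Theta(h,Q,t)=\frac{(2\sqrt2)^n}{\mathrm{Vol}_g\big(\varphi(\{x_0\}\times B(r'))\big)}\int_U\frac{1}{(4\pi(T'-t))^{n/2}}\exp\Big(-\frac{|\mathcal P(t)|^2}{4(T'-t)}\Big)\,\tilde f\Big(\frac{4|\mathcal P(t)|}{\lambda r}\Big)\,d\mu(\tilde h_t),$$ where the fibre volume is taken with respect to the Riemannian metric $g$, for which $g(\partial_{y^i},\partial_{y^j})=2g_{\bar ij}$ on $U$. **Theorem.** For every $Q=(p,T')\in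 U_{r/4}\times(0,T)$ the limit $\bar\Theta(h,Q):=\lim_{t\nearrow T'}\bar\Theta(h,Q,t)$ exists in $\mathbb R$, and $$1\le\bar\Theta(h,Q).$$ -/

import Mathlib

open scoped ContDiff Manifold Topology Bundle
open Set Filter MeasureTheory Bundle

noncomputable section

namespace LBMCF

/-- The model space `ℂⁿ` of complex manifolds of dimension `n`. -/
abbrev Cn (n : ℕ) : Type := EuclideanSpace ℂ (Fin n)

/-- `ℝⁿ` with the Euclidean norm. -/
abbrev Rn (n : ℕ) : Type := EuclideanSpace ℝ (Fin n)

/-! ### Coordinates `z = x + i y` on `ℂⁿ` and coordinate derivatives -/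

/-- The real part `x` of `z = x + i y`. -/
def xPart {n : ℕ} (z : Cn n) : Rn n := WithLp.toLp 2 fun i => (z i).re

/-- The imaginary part `y` of `z = x + i y`. -/
def yPart {n : ℕ} (z : Cn n) : Rn n := WithLp.toLp 2 fun i => (z i).im

/-- The point `x + i y` of `ℂⁿ`. -/
def mkC {n : ℕ} (x y : Rn n) : Cn n :=
  WithLp.toLp 2 fun i => (x i : ℂ) + (y i : ℂ) * Complex.I

/-- `∂f/∂xʲ` at `z`. -/
def dX {n : ℕ} {V : Type*} [NormedAddCommGroup V] [NormedSpace ℝ V]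
    (j : Fin n) (f : Cn n → V) (z : Cn n) : V :=
  fderiv ℝ f z (EuclideanSpace.single j (1 : ℂ))

/-- `∂f/∂yʲ` at `z`. -/
def dY {n : ℕ} {V : Type*} [NormedAddCommGroup V] [NormedSpace ℝ V]
    (j : Fin n) (f : Cn n → V) (z : Cn n) : V :=
  fderiv ℝ f z (EuclideanSpace.single j Complex.I)

/-- `∂f/∂zʲ = (∂f/∂xʲ - i ∂f/∂yʲ) / 2`. -/
def dZ {n : ℕ} (j : Fin n) (f : Cn n → ℂ) (z : Cn n) : ℂ :=
  (1 / 2 : ℂ) * (dX j f z - Complex.I * dY j f z)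

/-- `∂f/∂z̄ʲ = (∂f/∂xʲ + i ∂f/∂yʲ) / 2`. -/
def dZbar {n : ℕ} (j : Fin n) (f : Cn n → ℂ) (z : Cn n) : ℂ :=
  (1 / 2 : ℂ) * (dX j f z + Complex.I * dY j f z)

/-! ### Kähler metrics -/

/-- The holomorphic charts of a complex manifold `X`. -/
abbrev holChart (n : ℕ) (X : Type*) [TopologicalSpace X] [ChartedSpace (Cn n) X] :
    Set (OpenPartialHomeomorph X (Cn n)) :=
  IsManifold.maximalAtlas 𝓘(ℂ, Cn n) ω X

/-- The tangent vector with complex coordinates `v` at the point of `X` whose coordinate in the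
chart `c` is `z`.  The basis vector `single j 1` gives `∂/∂zʲ` (equivalently, `∂/∂xʲ`, under the
identification of the real tangent space with `T^{1,0}`), and `single j i` gives `∂/∂yʲ`. -/
def coordVec {n : ℕ} {X : Type*} [TopologicalSpace X] [ChartedSpace (Cn n) X]
    (c : OpenPartialHomeomorph X (Cn n)) (z : Cn n) (v : Cn n) :
    TangentSpace 𝓘(ℂ, Cn n) (c.symm z) :=
  mfderiv 𝓘(ℂ, Cn n) 𝓘(ℂ, Cn n) c.symm z v

/-- The coefficients `g_{k̄j}` in the chart `c` of a family `G` of sesquilinear forms on the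
holomorphic tangent spaces: `coeff G c z k j = G(∂/∂zᵏ, ∂/∂zʲ)`. -/
def coeff {n : ℕ} {X : Type*} [TopologicalSpace X] [ChartedSpace (Cn n) X]
    (G : ∀ x : X, TangentSpace 𝓘(ℂ, Cn n) x →ₗ⋆[ℂ] TangentSpace 𝓘(ℂ, Cn n) x →ₗ[ℂ] ℂ)
    (c : OpenPartialHomeomorph X (Cn n)) (z : Cn n) : Matrix (Fin n) (Fin n) ℂ :=
  Matrix.of fun k j =>
    G (c.symm z) (coordVec c z (EuclideanSpace.single k 1))
      (coordVec c z (EuclideanSpace.single j 1))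

/-- A Kähler metric on the complex manifold `X`, given as a smooth Hermitian metric on the
holomorphic tangent bundle (conjugate-linear in the first variable) with closed Kähler form
`(i/2) g_{k̄j} dzʲ ∧ dz̄ᵏ`; closedness is written in holomorphic coordinates. -/
structure KahlerMetric (n : ℕ) (X : Type*) [TopologicalSpace X] [ChartedSpace (Cn n) X] where
  /-- The Hermitian form on the tangent spaces. -/
  form : ∀ x : X, TangentSpace 𝓘(ℂ, Cn n) x →ₗ⋆[ℂ] TangentSpace 𝓘(ℂ, Cn n) x →ₗ[ℂ] ℂ
  conj_symm : ∀ x v w, starRingEnd ℂ (form x v w) = form x w v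
  pos : ∀ x v, v ≠ 0 → 0 < (form x v v).re
  smooth : ∀ c ∈ holChart n X, ∀ k j : Fin n,
    ContDiffOn ℝ ∞ (fun z => coeff form c z k j) c.target
  closed : ∀ c ∈ holChart n X, ∀ z ∈ c.target, ∀ j k l : Fin n,
    dZ l (fun w => coeff form c w k j) z = dZ j (fun w => coeff form c w k l) z

/-- The matrix `(g_{k̄j})` of the metric in the chart `c`. -/
def KahlerMetric.mat {n : ℕ} {X : Type*} [TopologicalSpace X] [ChartedSpace (Cn n) X]
    (g : KahlerMetric n X) (c : OpenPartialHomeomorph X (Cn n)) (z : Cn n) :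
    Matrix (Fin n) (Fin n) ℂ :=
  coeff g.form c z

/-- The underlying Riemannian metric, normalized by `g_{k̄j} = g(∂/∂zʲ, ∂/∂z̄ᵏ)` (complex bilinear
extension), that is, `g(∂/∂xⁱ, ∂/∂xʲ) = g(∂/∂yⁱ, ∂/∂yʲ) = g_{īj} + g_{j̄i}`. -/
def KahlerMetric.riem {n : ℕ} {X : Type*} [TopologicalSpace X] [ChartedSpace (Cn n) X]
    (g : KahlerMetric n X) (x : X) (v w : TangentSpace 𝓘(ℂ, Cn n) x) : ℝ :=
  2 * (g.form x v w).re

/-! ### Holomorphic line bundles, Hermitian metrics, curvature, angle -/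

section LineBundle

variable {n : ℕ} {X : Type*} [TopologicalSpace X] [ChartedSpace (Cn n) X]
  (L : X → Type*) [TopologicalSpace (TotalSpace ℂ L)]
  [∀ x, AddCommGroup (L x)] [∀ x, Module ℂ (L x)] [∀ x, TopologicalSpace (L x)]
  [FiberBundle ℂ L]

/-- `e` is a nonvanishing holomorphic section of the line bundle `L` over `W`. -/
def IsHolFrame (n : ℕ) {X : Type*} [TopologicalSpace X] [ChartedSpace (Cn n) X]
    (L : X → Type*) [TopologicalSpace (TotalSpace ℂ L)]
    [∀ x, AddCommGroup (L x)] [∀ x, TopologicalSpace (L x)] [FiberBundle ℂ L]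
    (e : ∀ x, L x) (W : Set X) : Prop :=
  ContMDiffOn 𝓘(ℂ, Cn n) (𝓘(ℂ, Cn n).prod 𝓘(ℂ, ℂ)) ω
    (fun x => TotalSpace.mk' ℂ x (e x)) W ∧ ∀ x ∈ W, e x ≠ 0

/-- A smooth Hermitian metric on the holomorphic line bundle `L`, conjugate-linear in the first
variable.  Smoothness: `h(ē, e)` is smooth in holomorphic charts for each local holomorphic frame. -/
structure HermitianMetric (n : ℕ) {X : Type*} [TopologicalSpace X] [ChartedSpace (Cn n) X]
    (L : X → Type*) [TopologicalSpace (TotalSpace ℂ L)]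
    [∀ x, AddCommGroup (L x)] [∀ x, Module ℂ (L x)] [∀ x, TopologicalSpace (L x)]
    [FiberBundle ℂ L] where
  /-- The Hermitian form on the fibres. -/
  form : ∀ x : X, L x →ₗ⋆[ℂ] L x →ₗ[ℂ] ℂ
  conj_symm : ∀ x v w, starRingEnd ℂ (form x v w) = form x w v
  pos : ∀ x v, v ≠ 0 → 0 < (form x v v).re
  smooth : ∀ c ∈ holChart n X, ∀ (W : Set X) (e : ∀ x, L x), IsOpen W → IsHolFrame n L e W →
    ContDiffOn ℝ ∞ (fun z => (form (c.symm z) (e (c.symm z)) (e (c.symm z))).re)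
      (c.target ∩ c.symm ⁻¹' W)

variable {L}

/-- The local potential `φ = -log h(ē, e)` in the chart `c`. -/
def HermitianMetric.potential (h : HermitianMetric n L) (c : OpenPartialHomeomorph X (Cn n))
    (e : ∀ x, L x) (z : Cn n) : ℝ :=
  -Real.log (h.form (c.symm z) (e (c.symm z)) (e (c.symm z))).re

end LineBundle

/-- The matrix `(F_{k̄j})` with `F_{k̄j} = -∂_j ∂_k̄ log h = ∂_j ∂_k̄ φ` of the curvature
`F = (1/2) F_{k̄j} dzʲ ∧ dz̄ᵏ` of the Hermitian metric `h = e^{-φ}`. -/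
def curv {n : ℕ} (φ : Cn n → ℝ) (z : Cn n) : Matrix (Fin n) (Fin n) ℂ :=
  Matrix.of fun k j => dZ j (dZbar k fun w => (φ w : ℂ)) z

/-- `θ = arctan λ₁ + ⋯ + arctan λₙ`, where `λᵢ` are the eigenvalues (with multiplicity) of
`K = g⁻¹ F`. -/
def angle {n : ℕ} (g F : Matrix (Fin n) (Fin n) ℂ) : ℝ :=
  ((g⁻¹ * F).charpoly.roots.map fun μ => Real.arctan μ.re).sum

/-- `ζ = (ω - F)ⁿ / ωⁿ` with `ω = (1/2) (i g_{k̄j}) dzʲ ∧ dz̄ᵏ` and `F = (1/2) F_{k̄j} dzʲ ∧ dz̄ᵏ`: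
the quotient of the determinants of the coefficient matrices. -/
def zeta {n : ℕ} (g F : Matrix (Fin n) (Fin n) ℂ) : ℂ :=
  (Complex.I • g - F).det / (Complex.I • g).det

/-- The time interval `[0, T)`, where `T` may be `∞`. -/
def timeSet (T : EReal) : Set ℝ := {t | 0 ≤ t ∧ (t : EReal) < T}

/-- `h = {h_t}`, `t ∈ [0, T)`, is a line bundle mean curvature flow of `L → X` with respect to `g`:
a smooth family of Hermitian metrics `h_t = e^{-u(t)} h_0` with `du/dt = θ(h_t) - θ̂` for some
constant `θ̂`. -/
structure IsLineBundleMCF {n : ℕ} {X : Type*} [TopologicalSpace X] [ChartedSpace (Cn n) X]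
    {L : X → Type*} [TopologicalSpace (TotalSpace ℂ L)]
    [∀ x, AddCommGroup (L x)] [∀ x, Module ℂ (L x)] [∀ x, TopologicalSpace (L x)]
    [FiberBundle ℂ L]
    (g : KahlerMetric n X) (h : ℝ → HermitianMetric n L) (T : EReal) : Prop where
  smooth : ∀ c ∈ holChart n X, ∀ (W : Set X) (e : ∀ x, L x), IsOpen W → IsHolFrame n L e W →
    ContDiffOn ℝ ∞
      (fun q : Cn n × ℝ => ((h q.2).form (c.symm q.1) (e (c.symm q.1)) (e (c.symm q.1))).re)
      ((c.target ∩ c.symm ⁻¹' W) ×ˢ timeSet T)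
  flow : ∃ (θhat : ℝ) (u : X → ℝ → ℝ),
    (∀ t ∈ timeSet T, ∀ x v w,
      (h t).form x v w = (Real.exp (-u x t) : ℂ) * (h 0).form x v w) ∧
    ∀ c ∈ holChart n X, ∀ (W : Set X) (e : ∀ x, L x), IsOpen W → IsHolFrame n L e W →
      ∀ x ∈ c.source ∩ W, ∀ t ∈ timeSet T,
        HasDerivWithinAt (u x)
          (angle (g.mat c (c x)) (curv ((h t).potential c e) (c x)) - θhat) (timeSet T) t

/-! ### Semi-flat and graphical -/

/-- `(X, g)` is semi-flat on `U` with respect to the biholomorphic map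
`ψ⁻¹ : B(r) × B(r') → U`. -/
structure IsSemiFlat {n : ℕ} {X : Type*} [TopologicalSpace X] [ChartedSpace (Cn n) X]
    (g : KahlerMetric n X) (U : Set X) (r r' : ℝ) (ψ : OpenPartialHomeomorph X (Cn n)) :
    Prop where
  mem_atlas : ψ ∈ holChart n X
  source_eq : ψ.source = U
  target_eq : ψ.target =
    {z | xPart z ∈ Metric.ball (0 : Rn n) r ∧ yPart z ∈ Metric.ball (0 : Rn n) r'}
  coeff_symm : ∀ z ∈ ψ.target, ∀ i j : Fin n, g.mat ψ z i j = g.mat ψ z j i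
  coeff_y : ∀ z ∈ ψ.target, ∀ i j k : Fin n, dY k (fun w => g.mat ψ w i j) z = 0

/-- `(L, h)` is graphical on `U` (the domain of the semi-flat chart `ψ`) with respect to the
nonvanishing holomorphic section `e` over `U`. -/
structure IsGraphical {n : ℕ} {X : Type*} [TopologicalSpace X] [ChartedSpace (Cn n) X]
    {L : X → Type*} [TopologicalSpace (TotalSpace ℂ L)]
    [∀ x, AddCommGroup (L x)] [∀ x, Module ℂ (L x)] [∀ x, TopologicalSpace (L x)]
    [FiberBundle ℂ L]
    (h : HermitianMetric n L) (ψ : OpenPartialHomeomorph X (Cn n)) (e : ∀ x, L x) : Prop where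
  frame : IsHolFrame n L e ψ.source
  log_y : ∀ z ∈ ψ.target, ∀ k : Fin n,
    dY k (fun w => Real.log (h.form (ψ.symm w) (e (ψ.symm w)) (e (ψ.symm w))).re) z = 0

/-! ### The Gaussian density -/

/-- `λ`: the square root of the infimum over `U` of the lowest eigenvalue of `(g_{īj})`. -/
def lam {n : ℕ} {X : Type*} [TopologicalSpace X] [ChartedSpace (Cn n) X]
    (g : KahlerMetric n X) (ψ : OpenPartialHomeomorph X (Cn n)) : ℝ :=
  √(sInf {μ : ℝ | ∃ z ∈ ψ.target,
    Module.End.HasEigenvalue (Matrix.toLin' (g.mat ψ z)) (μ : ℂ)})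

/-- An admissible cut-off function `f̃ : ℝ → [0, 1]`. -/
structure IsCutoff (f : ℝ → ℝ) : Prop where
  smooth : ContDiff ℝ ∞ f
  range : ∀ s, f s ∈ Icc (0 : ℝ) 1
  strictAnti : StrictAntiOn f (Icc 1 2)
  eq_one : ∀ s ≤ 1, f s = 1
  eq_zero : ∀ s, 2 ≤ s → f s = 0
  bound : ∃ C' > 0, ∀ s, |deriv f s| + |deriv (deriv f) s| ≤ C'

/-- The squared norm of `Yʲ ∂/∂zʲ ⊕ Y_j̄ dz̄ʲ`, namely
`g_{j̄k} conj(Yʲ) Yᵏ + g^{jk̄} conj(Y_j̄) Y_k̄`. -/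
def sectionNormSq {n : ℕ} (g : Matrix (Fin n) (Fin n) ℂ) (Y Y' : Fin n → ℂ) : ℝ :=
  ((∑ j, ∑ k, g j k * starRingEnd ℂ (Y j) * Y k) +
    ∑ j, ∑ k, g⁻¹ j k * starRingEnd ℂ (Y' j) * Y' k).re

/-- The norm `|𝒫_p|` at `z` of the position section
`2 (xᵏ - x₀ᵏ) ∂/∂zᵏ ⊕ (1/2) (∂φ/∂xᵏ) dz̄ᵏ` of the metric `e^{-φ}`, centered at the point with
coordinate `z₀`. -/
def posNorm {n : ℕ} (g : Matrix (Fin n) (Fin n) ℂ) (φ : Cn n → ℝ) (z₀ z : Cn n) : ℝ :=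
  √(sectionNormSq g
    (fun k => ((2 * (xPart z k - xPart z₀ k) : ℝ) : ℂ))
    (fun k => ((1 / 2 * dX k φ z : ℝ) : ℂ)))

/-- The density of the measure `dμ(h) = |ζ| ωⁿ/n!` of `h = e^{-φ}` with respect to `dx dy`;
the density of `ωⁿ/n!` is `det (g_{k̄j})`. -/
def muDensity {n : ℕ} (g F : Matrix (Fin n) (Fin n) ℂ) : ℝ := ‖zeta g F‖ * g.det.re

section Density

variable {n : ℕ} {X : Type*} [TopologicalSpace X] [ChartedSpace (Cn n) X]

/-- `Θ(h, Q, t)` for the family of metrics `h_t = e^{-φ(t)}` over `U = ψ⁻¹(B(r) × B(r'))`, where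
`Q = (p, T')` and `z₀` is the coordinate of `p`. -/
def Theta (g : KahlerMetric n X) (ψ : OpenPartialHomeomorph X (Cn n)) (r r' : ℝ) (f : ℝ → ℝ)
    (φ : Cn n → ℝ → ℝ) (z₀ : Cn n) (T' t : ℝ) : ℝ :=
  ∫ q in Metric.ball (0 : Rn n) r ×ˢ Metric.ball (0 : Rn n) r',
    (1 / (4 * Real.pi * (T' - t)) ^ ((n : ℝ) / 2)) *
      Real.exp (-(posNorm (g.mat ψ (mkC q.1 q.2)) (fun w => φ w t) z₀ (mkC q.1 q.2)) ^ 2 /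
        (4 * (T' - t))) *
      f (4 * posNorm (g.mat ψ (mkC q.1 q.2)) (fun w => φ w t) z₀ (mkC q.1 q.2) /
        (lam g ψ * r)) *
      muDensity (g.mat ψ (mkC q.1 q.2)) (curv (fun w => φ w t) (mkC q.1 q.2))

/-- `(A_Q φ)(t)`: `φ(t)` minus the first order Taylor polynomial in `x` of `φ(T')` at the centre. -/
def translate (φ : Cn n → ℝ → ℝ) (z₀ : Cn n) (T' : ℝ) (z : Cn n) (t : ℝ) : ℝ :=
  φ z t - (φ z₀ T' + ∑ i, dX i (fun w => φ w T') z₀ * (xPart z i - xPart z₀ i))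

/-- `Vol_g(B(r')_p)`: the Riemannian volume of the fibre `ψ⁻¹({x₀} × B(r'))`. -/
def fibreVol (g : KahlerMetric n X) (ψ : OpenPartialHomeomorph X (Cn n)) (r' : ℝ) (z₀ : Cn n) :
    ℝ :=
  ∫ y in Metric.ball (0 : Rn n) r',
    √(Matrix.det (Matrix.of fun i j : Fin n =>
      g.riem (ψ.symm (mkC (xPart z₀) y))
        (coordVec ψ (mkC (xPart z₀) y) (EuclideanSpace.single i Complex.I))
        (coordVec ψ (mkC (xPart z₀) y) (EuclideanSpace.single j Complex.I))))

/-- The Gaussian density `Θ̄(h, Q, t)` of `h` at `Q = (p, T')` with scale `t`. -/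
def gaussianDensity {L : X → Type*} [TopologicalSpace (TotalSpace ℂ L)]
    [∀ x, AddCommGroup (L x)] [∀ x, Module ℂ (L x)] [∀ x, TopologicalSpace (L x)]
    [FiberBundle ℂ L]
    (g : KahlerMetric n X) (ψ : OpenPartialHomeomorph X (Cn n)) (r r' : ℝ) (f : ℝ → ℝ)
    (e : ∀ x, L x) (h : ℝ → HermitianMetric n L) (p : X) (T' t : ℝ) : ℝ :=
  (2 * √2) ^ n / fibreVol g ψ r' (ψ p) *
    Theta g ψ r r' f (translate (fun z s => (h s).potential ψ e z) (ψ p) T') (ψ p) T' t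

end Density

end LBMCF

end

/-! The limit exists and is exactly $1$, because a smooth graph looks like its tangent plane at
small scales and the normalizing constant is chosen so that a plane has density $1$.

On the semi-flat chart neither the metric nor the potential depends on $y$, so the integral over $U$
is the volume of $B(r')$ times an integral over the base (`Theta_translate`). There $g$ is a real
positive matrix $G(x)$ and the curvature is $F=\frac14\,\mathrm{Hess}_x\phi$. Put $\tau=T'-t$ and
$x=x_0+\sqrt\tau\,\xi$; the Jacobian $\tau^{n/2}$ cancels the singular part of the heat kernel.
Since $\tilde\phi$ has zero gradient at $(x_0,T')$, the exponent $|\mathcal P|^2/4\tau$ tends to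
$\xi^{\mathsf T}A\xi$ with $A=G+FG^{-1}F$ evaluated at the centre (`tendsto_posNormX_parabolic`).
The cut-off tends to $1$ and the density to $|\det(iG-F)|=\sqrt{\det G\,\det A}$
(`graphDensity_eq`). Dominated convergence (`tendsto_gaussian_concentration`) applies because the
eigenvalue bound $\lambda^2$ gives $|\mathcal P|\ge 2\lambda|x-x_0|$.

The Gaussian integral of $A$ is $\pi^{n/2}/\sqrt{\det A}$, so $\det A$ drops out and the base
integral tends to $\sqrt{\det G}/2^n$ (`tendsto_base_integral`). The fibre volume is
$2^{n/2}\sqrt{\det G}$ times that of $B(r')$ (`IsSemiFlat.fibreVol_eq`), and the prefactor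
$(2\sqrt2)^n$ makes the quotient $1$. -/

noncomputable section

namespace LBMCF

open Matrix

/-! ### Gaussian integrals and the linear algebra of graphs. -/

open scoped MatrixOrder in
theorem exists_eq_transpose_mul_self {n : ℕ} {A : Matrix (Fin n) (Fin n) ℝ} (hA : A.PosDef) :
    ∃ B : Matrix (Fin n) (Fin n) ℝ, A = Bᵀ * B := by
  obtain ⟨B, hB⟩ := CStarAlgebra.nonneg_iff_eq_star_mul_self.mp hA.posSemidef.nonneg
  exact ⟨B, by rw [hB, Matrix.star_eq_conjTranspose, conjTranspose_eq_transpose_of_trivial]⟩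

/-- With $A=B^{\mathsf T}B$ the exponent is $-|B\xi|^2$, so $\eta=B\xi$ reduces to the standard
Gaussian with Jacobian $|\det B|=\sqrt{\det A}$. -/
theorem integral_exp_neg_quadratic {n : ℕ} {A : Matrix (Fin n) (Fin n) ℝ} (hA : A.PosDef) :
    ∫ ξ : Rn n, Real.exp (-(ξ.ofLp ⬝ᵥ A *ᵥ ξ.ofLp)) = Real.pi ^ ((n : ℝ) / 2) / √A.det := by
  obtain ⟨B, rfl⟩ := exists_eq_transpose_mul_self hA
  have hdet : (Bᵀ * B).det = B.det ^ 2 := by rw [det_mul, det_transpose, sq]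
  have hB : B.det ≠ 0 := by
    intro h
    have := hA.det_pos
    rw [hdet, h] at this
    simp at this
  have hq : ∀ ξ : Rn n, ξ.ofLp ⬝ᵥ (Bᵀ * B) *ᵥ ξ.ofLp = ‖toEuclideanLin B ξ‖ ^ 2 := by
    intro ξ
    rw [← mulVec_mulVec, dotProduct_mulVec, vecMul_transpose, EuclideanSpace.norm_sq_eq]
    simp only [dotProduct, Real.norm_eq_abs, sq_abs]
    exact Finset.sum_congr rfl fun i _ => (sq _).symm
  have hTdet : LinearMap.det (toEuclideanLin B) = B.det := by
    simp [toEuclideanLin]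
  have hmap := Measure.map_linearMap_addHaar_eq_smul_addHaar (volume : Measure (Rn n))
    (f := toEuclideanLin B) (by rw [hTdet]; exact hB)
  have hgauss := GaussianFourier.integral_rexp_neg_mul_sq_norm (V := Rn n) (b := 1) one_pos
  simp only [hq]
  have h1 : ∫ ξ : Rn n, Real.exp (-‖toEuclideanLin B ξ‖ ^ 2) =
      ∫ η : Rn n, Real.exp (-‖η‖ ^ 2) ∂(Measure.map (toEuclideanLin B) volume) := by
    rw [integral_map]
    · exact (LinearMap.continuous_of_finiteDimensional _).aemeasurable
    · exact (by fun_prop : Continuous fun η : Rn n => Real.exp (-‖η‖ ^ 2)).aestronglyMeasurable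
  rw [h1, hmap, integral_smul_measure, ENNReal.toReal_ofReal (abs_nonneg _), hTdet, hdet,
    Real.sqrt_sq_eq_abs]
  simp only [neg_mul, one_mul, div_one, finrank_euclideanSpace, Fintype.card_fin] at hgauss
  rw [hgauss, smul_eq_mul, abs_inv]
  field_simp

/-- `G + F G⁻¹ F` is the metric induced on the graph whose second fundamental data are `F`. -/
theorem posDef_graph {n : ℕ} {G F : Matrix (Fin n) (Fin n) ℝ} (hG : G.PosDef) (hF : Fᵀ = F) :
    (G + F * G⁻¹ * F).PosDef := by
  have h := hG.inv.posSemidef.conjTranspose_mul_mul_same F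
  rw [conjTranspose_eq_transpose_of_trivial, hF] at h
  exact hG.add_posSemidef h

/-- The absolute value of `det (iG - F)`. -/
def graphDensity {n : ℕ} (G F : Matrix (Fin n) (Fin n) ℝ) : ℝ :=
  ‖(Complex.I • G.map Complex.ofReal - F.map Complex.ofReal).det‖

theorem continuous_graphDensity {n : ℕ} :
    Continuous fun q : Matrix (Fin n) (Fin n) ℝ × Matrix (Fin n) (Fin n) ℝ =>
      graphDensity q.1 q.2 := by
  refine (Continuous.matrix_det (Continuous.sub ?_ ?_)).norm
  · exact (continuous_fst.matrix_map Complex.continuous_ofReal).const_smul Complex.I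
  · exact continuous_snd.matrix_map Complex.continuous_ofReal

/-- Take determinants in $(-iG-F)\,G^{-1}(iG-F)=G+FG^{-1}F$. As $G$ and $F$ are real, the outer
factors are complex conjugates, so the left side is $|\det(iG-F)|^2/\det G$. -/
theorem graphDensity_eq {n : ℕ} {G F : Matrix (Fin n) (Fin n) ℝ} (hG : G.PosDef) :
    graphDensity G F = √(G.det * (G + F * G⁻¹ * F).det) := by
  rw [graphDensity]
  set ι : ℝ →+* ℂ := Complex.ofRealHom
  have hGu : IsUnit G.det := hG.det_pos.ne'.isUnit
  have hmap : ∀ A : Matrix (Fin n) (Fin n) ℝ, A.map Complex.ofReal = ι.mapMatrix A := fun _ => rfl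
  simp only [hmap]
  set g := ι.mapMatrix G
  set k := ι.mapMatrix F
  set gi := ι.mapMatrix G⁻¹
  have hgi : g * gi = 1 := by
    rw [← map_mul, mul_nonsing_inv _ hGu, map_one]
  have hig : gi * g = 1 := by
    rw [← map_mul, nonsing_inv_mul _ hGu, map_one]
  have hprod : (-Complex.I • g - k) * gi * (Complex.I • g - k) = g + k * gi * k := by
    have e1 : (-Complex.I • g - k) * gi =
        -(Complex.I • (1 : Matrix (Fin n) (Fin n) ℂ) + k * gi) := by
      rw [sub_mul, smul_mul_assoc, hgi, neg_smul, neg_add']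
    have hII : Complex.I • Complex.I • g = -g := by
      rw [smul_smul, Complex.I_mul_I, neg_one_smul]
    have h1 : Complex.I • (1 : Matrix (Fin n) (Fin n) ℂ) * (Complex.I • g - k) =
        -g - Complex.I • k := by
      rw [smul_mul_assoc, one_mul, smul_sub, hII]
    have h2 : k * gi * (Complex.I • g - k) = Complex.I • k - k * gi * k := by
      rw [mul_sub, mul_smul_comm, mul_assoc k gi g, hig, mul_one]
    rw [e1, neg_mul, add_mul, h1, h2]
    abel
  have hconj : (-Complex.I • g - k).det = starRingEnd ℂ (Complex.I • g - k).det := by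
    rw [RingHom.map_det]
    congr 1
    ext i j
    simp [g, k, ι]
  have hd : (g + k * gi * k) = ι.mapMatrix (G + F * G⁻¹ * F) := by
    simp only [map_add, map_mul, g, k, gi]
  have hdet := congrArg det hprod
  rw [det_mul, det_mul, hconj, hd] at hdet
  have hgdet : gi.det * g.det = 1 := by rw [← det_mul, hig, det_one]
  have hsq : ((‖(Complex.I • g - k).det‖ ^ 2 : ℝ) : ℂ) =
      ((G.det * (G + F * G⁻¹ * F).det : ℝ) : ℂ) := by
    have hG' : g.det = ((G.det : ℝ) : ℂ) := (RingHom.map_det ι G).symm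
    have hA' : (ι.mapMatrix (G + F * G⁻¹ * F)).det = (((G + F * G⁻¹ * F).det : ℝ) : ℂ) :=
      (RingHom.map_det ι _).symm
    rw [← Complex.normSq_eq_norm_sq, ← Complex.mul_conj]
    push_cast
    rw [← hG', ← hA', ← hdet]
    linear_combination (-(Complex.I • g - k).det * starRingEnd ℂ (Complex.I • g - k).det) * hgdet
  rw [← Complex.ofReal_inj.1 hsq, Real.sqrt_sq (norm_nonneg _)]

/-- The denominator of $\zeta$ has modulus $|\det(iG)|=\det G$, which cancels the density of
$\omega^n/n!$. -/
theorem muDensity_eq {n : ℕ} {G : Matrix (Fin n) (Fin n) ℝ} (hG : G.PosDef)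
    (F : Matrix (Fin n) (Fin n) ℝ) :
    muDensity (G.map Complex.ofReal) (F.map Complex.ofReal) = graphDensity G F := by
  have hdet : (G.map Complex.ofReal).det = ((G.det : ℝ) : ℂ) :=
    (RingHom.map_det Complex.ofRealHom G).symm
  have := hG.det_pos
  rw [graphDensity, muDensity, zeta, det_smul, norm_div, norm_mul, hdet, norm_pow,
    Complex.norm_I, one_pow, one_mul, Complex.ofReal_re, Complex.norm_real, Real.norm_of_nonneg this.le,
    div_mul_cancel₀ _ this.ne']

theorem sectionNormSq_ofReal {n : ℕ} (G : Matrix (Fin n) (Fin n) ℝ) (v w : Fin n → ℝ) :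
    sectionNormSq (G.map Complex.ofReal) (fun k => ((v k : ℝ) : ℂ)) (fun k => ((w k : ℝ) : ℂ)) =
      v ⬝ᵥ G *ᵥ v + w ⬝ᵥ G⁻¹ *ᵥ w := by
  have hinv : (G.map Complex.ofReal)⁻¹ = G⁻¹.map Complex.ofReal := by
    have h1 : (G.map Complex.ofReal) = Complex.ofRealHom.mapMatrix G := rfl
    have h2 : G⁻¹.map Complex.ofReal = Complex.ofRealHom.mapMatrix G⁻¹ := rfl
    rw [h1, h2, Matrix.inv_def, Matrix.inv_def, ← RingHom.map_det, ← RingHom.map_adjugate]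
    ext i j
    simp
  rw [sectionNormSq, hinv]
  simp only [Complex.conj_ofReal, map_apply, ← Complex.ofReal_mul, ← Complex.ofReal_sum,
    ← Complex.ofReal_add, Complex.ofReal_re, dotProduct, mulVec, Finset.mul_sum]
  congr 1 <;> refine Finset.sum_congr rfl fun i _ => Finset.sum_congr rfl fun j _ => by ring

/-! ### Parabolic rescaling and concentration of heat-kernel integrals. -/

/-- The indicator replaces the moving domain of $\xi$ by the whole space, so that dominated
convergence can be applied on a fixed domain. -/
theorem integral_ball_rescale {n : ℕ} (x0 : Rn n) {r s : ℝ} (hs : 0 < s) (F : Rn n → ℝ) :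
    ∫ x in Metric.ball (0 : Rn n) r, F x =
      s ^ n * ∫ ξ, (Metric.ball (0 : Rn n) r).indicator F (x0 + s • ξ) := by
  have h1 := Measure.integral_comp_smul (volume : Measure (Rn n))
    (fun x => (Metric.ball (0 : Rn n) r).indicator F (x0 + x)) s
  rw [h1, integral_add_left_eq_self (μ := (volume : Measure (Rn n)))
    (fun x => (Metric.ball (0 : Rn n) r).indicator F x) x0,
    integral_indicator Metric.isOpen_ball.measurableSet]
  have : (0 : ℝ) < s ^ n := by positivity
  simp only [finrank_euclideanSpace, Fintype.card_fin, smul_eq_mul, abs_inv, abs_of_pos this]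
  field_simp

theorem gaussian_factor_rescale (n : ℕ) {τ : ℝ} (hτ : 0 < τ) :
    1 / (4 * Real.pi * τ) ^ ((n : ℝ) / 2) * √τ ^ n = 1 / (4 * Real.pi) ^ ((n : ℝ) / 2) := by
  have h4 : 0 < 4 * Real.pi := by positivity
  rw [Real.mul_rpow h4.le hτ.le]
  have : τ ^ ((n : ℝ) / 2) = √τ ^ n := by
    rw [Real.sqrt_eq_rpow, ← Real.rpow_natCast, ← Real.rpow_mul hτ.le]
    congr 1; ring
  rw [this]
  have : 0 < √τ := Real.sqrt_pos.2 hτ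
  field_simp

theorem tendsto_sqrt_sub (T' : ℝ) : Tendsto (fun t : ℝ => √(T' - t)) (𝓝[<] T') (𝓝[>] 0) := by
  refine tendsto_nhdsWithin_iff.2 ⟨?_, ?_⟩
  · have : Continuous fun t : ℝ => √(T' - t) := by fun_prop
    have h := this.tendsto T'
    simp only [sub_self, Real.sqrt_zero] at h
    exact h.mono_left nhdsWithin_le_nhds
  · filter_upwards [self_mem_nhdsWithin] with t ht
    exact Real.sqrt_pos.2 (sub_pos.2 ht)

/-- Heat-kernel type integrals concentrate at the centre: the rescaled exponent `q` and the value
of the density at the centre determine the limit. -/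
theorem tendsto_gaussian_concentration {n : ℕ} {r lam a b T' : ℝ} {x0 : Rn n}
    (hlam : 0 < lam) (hr : 0 < r) (hx0 : x0 ∈ Metric.ball (0 : Rn n) (r / 4)) (haT : a < T')
    (hTb : T' < b) {f : ℝ → ℝ} (hfc : Continuous f) (hf01 : ∀ s, f s ∈ Icc (0 : ℝ) 1)
    (hf0 : f 0 = 1) (hf2 : ∀ s, 2 ≤ s → f s = 0) {P M : Rn n → ℝ → ℝ} {q : Rn n → ℝ}
    (hP : ContinuousOn (Function.uncurry P) (Metric.ball 0 r ×ˢ Ioo a b))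
    (hM : ContinuousOn (Function.uncurry M) (Metric.ball 0 r ×ˢ Ioo a b))
    (hPlow : ∀ x ∈ Metric.ball (0 : Rn n) r, ∀ t ∈ Ioo a b, 2 * lam * ‖x - x0‖ ≤ P x t)
    (hP0 : P x0 T' = 0)
    (hlim : ∀ ξ, Tendsto (fun t => P (x0 + √(T' - t) • ξ) t ^ 2 / (4 * (T' - t))) (𝓝[<] T')
      (𝓝 (q ξ))) :
    Tendsto (fun t => ∫ x in Metric.ball (0 : Rn n) r,
        (1 / (4 * Real.pi * (T' - t)) ^ ((n : ℝ) / 2)) *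
          Real.exp (-(P x t) ^ 2 / (4 * (T' - t))) * f (4 * P x t / (lam * r)) * M x t)
      (𝓝[<] T')
      (𝓝 (1 / (4 * Real.pi) ^ ((n : ℝ) / 2) * (M x0 T' * ∫ ξ, Real.exp (-q ξ)))) := by
  set G : ℝ → Rn n → ℝ := fun t x =>
    Real.exp (-(P x t) ^ 2 / (4 * (T' - t))) * f (4 * P x t / (lam * r)) * M x t with hG
  have hx0r : x0 ∈ Metric.ball (0 : Rn n) r :=
    Metric.ball_subset_ball (by linarith) hx0
  have hopen : IsOpen (Metric.ball (0 : Rn n) r ×ˢ Ioo a b) := Metric.isOpen_ball.prod isOpen_Ioo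
  have hev : ∀ᶠ t in 𝓝[<] T', t ∈ Ioo a T' := Ioo_mem_nhdsLT haT
  -- rescaling
  have hrew : ∀ᶠ t in 𝓝[<] T', 1 / (4 * Real.pi) ^ ((n : ℝ) / 2) *
        (∫ ξ, (Metric.ball (0 : Rn n) r).indicator (G t) (x0 + √(T' - t) • ξ)) =
      ∫ x in Metric.ball (0 : Rn n) r,
        (1 / (4 * Real.pi * (T' - t)) ^ ((n : ℝ) / 2)) *
          Real.exp (-(P x t) ^ 2 / (4 * (T' - t))) * f (4 * P x t / (lam * r)) * M x t := by
    filter_upwards [hev] with t ht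
    have hτ : 0 < T' - t := sub_pos.2 ht.2
    have h1 : ∀ x, (1 / (4 * Real.pi * (T' - t)) ^ ((n : ℝ) / 2)) *
          Real.exp (-(P x t) ^ 2 / (4 * (T' - t))) * f (4 * P x t / (lam * r)) * M x t =
        (1 / (4 * Real.pi * (T' - t)) ^ ((n : ℝ) / 2)) * G t x := fun x => by
      simp only [hG]; ring
    simp only [h1]
    rw [integral_const_mul, integral_ball_rescale x0 (Real.sqrt_pos.2 hτ), ← mul_assoc,
      gaussian_factor_rescale n hτ]
  refine Tendsto.congr' hrew (Tendsto.const_mul _ ?_)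
  rw [← integral_const_mul]
  -- a bound for the density
  obtain ⟨c, hac, hcT⟩ := exists_between haT
  have hK : IsCompact (Metric.closedBall x0 (r / 4) ×ˢ Icc c T') :=
    (isCompact_closedBall x0 (r / 4)).prod isCompact_Icc
  have hKsub : Metric.closedBall x0 (r / 4) ×ˢ Icc c T' ⊆ Metric.ball (0 : Rn n) r ×ˢ Ioo a b := by
    refine prod_mono (fun x hx => ?_) (fun t ht => ⟨hac.trans_le ht.1, ht.2.trans_lt hTb⟩)
    rw [Metric.mem_closedBall] at hx
    rw [Metric.mem_ball] at hx0 ⊢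
    have := dist_triangle x x0 0
    linarith
  obtain ⟨C, hC⟩ := hK.exists_bound_of_continuousOn (hM.mono hKsub)
  have hC0 : 0 ≤ C := (norm_nonneg _).trans (hC (x0, T') ⟨Metric.mem_closedBall_self (by positivity),
    hcT.le, le_rfl⟩)
  -- The majorant: $P\ge 2\,lam\,\|x-x_0\|$ becomes $P^2/(4(T'-t))\ge lam^2\|\xi\|^2$ after
  -- rescaling.
  have hint : Integrable (fun ξ : Rn n => C * Real.exp (-lam ^ 2 * ‖ξ‖ ^ 2)) := by
    refine Integrable.const_mul ?_ _
    have h := GaussianFourier.integrable_cexp_neg_mul_sq_norm_add (V := Rn n)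
      (b := ((lam ^ 2 : ℝ) : ℂ)) (by rw [Complex.ofReal_re]; positivity) 0 0
    refine h.re.congr (Eventually.of_forall fun ξ => ?_)
    have h2 : (-((lam ^ 2 : ℝ) : ℂ) * (‖ξ‖ : ℂ) ^ 2 + 0 * (inner ℝ 0 ξ : ℝ)) =
        ((-lam ^ 2 * ‖ξ‖ ^ 2 : ℝ) : ℂ) := by
      push_cast; ring
    change (Complex.exp _).re = _
    rw [h2, ← Complex.ofReal_exp, Complex.ofReal_re]
  refine tendsto_integral_filter_of_dominated_convergence _ ?_ ?_ hint ?_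
  · filter_upwards [hev] with t ht
    have hτ : 0 < T' - t := sub_pos.2 ht.2
    have hs : √(T' - t) ≠ 0 := (Real.sqrt_pos.2 hτ).ne'
    have hmap : ContinuousOn (fun x => (x, t)) (Metric.ball (0 : Rn n) r) := by fun_prop
    have hmaps : MapsTo (fun x => (x, t)) (Metric.ball (0 : Rn n) r)
      (Metric.ball (0 : Rn n) r ×ˢ Ioo a b) := fun x hx => ⟨hx, ht.1, ht.2.trans hTb⟩
    have hPt : ContinuousOn (fun x => P x t) (Metric.ball 0 r) := hP.comp hmap hmaps
    have hMt : ContinuousOn (fun x => M x t) (Metric.ball 0 r) := hM.comp hmap hmaps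
    have hGt : ContinuousOn (G t) (Metric.ball 0 r) := by
      refine ContinuousOn.mul (ContinuousOn.mul ?_ ?_) hMt
      · exact Real.continuous_exp.comp_continuousOn (((hPt.pow 2).neg).div_const _)
      · exact hfc.comp_continuousOn ((continuousOn_const.mul hPt).div_const _)
    have hmeas : Measurable ((Metric.ball (0 : Rn n) r).indicator (G t)) := by
      classical
      rw [← piecewise_eq_indicator]
      exact hGt.measurable_piecewise continuousOn_const Metric.isOpen_ball.measurableSet
    exact (hmeas.comp (by fun_prop)).aestronglyMeasurable
  · have hev2 : ∀ᶠ t in 𝓝[<] T', t ∈ Ioo c T' := Ioo_mem_nhdsLT hcT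
    filter_upwards [hev2] with t ht
    refine Eventually.of_forall fun ξ => ?_
    have hτ : 0 < T' - t := sub_pos.2 ht.2
    have hRHS : 0 ≤ C * Real.exp (-lam ^ 2 * ‖ξ‖ ^ 2) := by positivity
    set x := x0 + √(T' - t) • ξ with hx
    by_cases hxr : x ∈ Metric.ball (0 : Rn n) r
    swap
    · simpa [indicator_of_notMem hxr] using hRHS
    rw [indicator_of_mem hxr]
    have hPl := hPlow x hxr t ⟨hac.trans ht.1, ht.2.trans hTb⟩
    have hxx : ‖x - x0‖ = √(T' - t) * ‖ξ‖ := by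
      rw [hx, add_sub_cancel_left, norm_smul, Real.norm_of_nonneg (Real.sqrt_nonneg _)]
    -- If $\|x-x_0\|\ge r/4$, then $4P/(lam\,r)\ge 8\|x-x_0\|/r\ge 2$ and the cut-off vanishes.
    -- Otherwise $(x,t)$ lies in the compact set on which $C$ bounds $M$.
    by_cases hfar : r / 4 ≤ ‖x - x0‖
    · have : f (4 * P x t / (lam * r)) = 0 := by
        apply hf2
        rw [le_div_iff₀ (by positivity)]
        nlinarith [mul_le_mul_of_nonneg_left hfar hlam.le]
      simpa [hG, this] using hRHS
    · have hMx : ‖M x t‖ ≤ C := hC (x, t) ⟨by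
        rw [Metric.mem_closedBall, dist_eq_norm]; exact (not_le.1 hfar).le, ht.1.le, ht.2.le⟩
      have hexp : Real.exp (-(P x t) ^ 2 / (4 * (T' - t))) ≤ Real.exp (-lam ^ 2 * ‖ξ‖ ^ 2) := by
        apply Real.exp_le_exp.2
        rw [div_le_iff₀ (by positivity)]
        have h0 : (2 * lam * ‖x - x0‖) ^ 2 ≤ P x t ^ 2 := by gcongr
        rw [hxx] at h0
        have hsq := Real.sq_sqrt hτ.le
        have : (2 * lam * (√(T' - t) * ‖ξ‖)) ^ 2 = 4 * lam ^ 2 * (T' - t) * ‖ξ‖ ^ 2 := by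
          rw [mul_pow, mul_pow, mul_pow √(T' - t), hsq]; ring
        nlinarith
      have hf1 := hf01 (4 * P x t / (lam * r))
      simp only [hG, norm_mul, Real.norm_eq_abs, Real.abs_exp, abs_of_nonneg hf1.1]
      calc _ ≤ Real.exp (-lam ^ 2 * ‖ξ‖ ^ 2) * 1 * C := by
            gcongr
            exacts [hf1.1, hf1.2, hMx]
        _ = _ := by ring
  · refine Eventually.of_forall fun ξ => ?_
    have hcurve : Tendsto (fun t => (x0 + √(T' - t) • ξ, t)) (𝓝[<] T') (𝓝 (x0, T')) := by
      have : Continuous fun t : ℝ => (x0 + √(T' - t) • ξ, t) := by fun_prop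
      have h := this.tendsto T'
      simp only [sub_self, Real.sqrt_zero, zero_smul, add_zero] at h
      exact h.mono_left nhdsWithin_le_nhds
    have hnhds : Metric.ball (0 : Rn n) r ×ˢ Ioo a b ∈ 𝓝 (x0, T') :=
      hopen.mem_nhds ⟨hx0r, haT, hTb⟩
    have hPl : Tendsto (fun t => P (x0 + √(T' - t) • ξ) t) (𝓝[<] T') (𝓝 (P x0 T')) :=
      (hP.continuousAt hnhds).tendsto.comp hcurve
    have hMl : Tendsto (fun t => M (x0 + √(T' - t) • ξ) t) (𝓝[<] T') (𝓝 (M x0 T')) :=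
      (hM.continuousAt hnhds).tendsto.comp hcurve
    -- For fixed $\xi$ the argument of the cut-off tends to $0$, since $P$ vanishes at the centre;
    -- hence the cut-off leaves no trace in the limit.
    have hfl : Tendsto (fun t => f (4 * P (x0 + √(T' - t) • ξ) t / (lam * r))) (𝓝[<] T')
        (𝓝 1) := by
      have : Tendsto (fun t => 4 * P (x0 + √(T' - t) • ξ) t / (lam * r)) (𝓝[<] T') (𝓝 0) := by
        have := (hPl.const_mul 4).div_const (lam * r)
        simpa [hP0] using this
      have h := (hfc.tendsto 0).comp this
      rwa [hf0] at h
    have hel := (Real.continuous_exp.tendsto _).comp (hlim ξ).neg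
    have hprod := (hel.mul hfl).mul hMl
    rw [show M x0 T' * Real.exp (-q ξ) = Real.exp (-q ξ) * 1 * M x0 T' by ring]
    refine hprod.congr' ?_
    have hin : ∀ᶠ t in 𝓝[<] T', (x0 + √(T' - t) • ξ, t) ∈ Metric.ball (0 : Rn n) r ×ˢ Ioo a b :=
      hcurve.eventually_mem hnhds
    filter_upwards [hin] with t ht
    rw [indicator_of_mem ht.1]
    simp only [hG, Function.comp, neg_div]

/-! ### Spatial derivatives of the potential along parabolic curves. -/

/-- The spatial derivative `∂φ/∂xᵏ` of a time-dependent function. -/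
def slopeX {n : ℕ} (φ : Rn n × ℝ → ℝ) (k : Fin n) (q : Rn n × ℝ) : ℝ :=
  fderiv ℝ φ q (EuclideanSpace.single k 1, 0)

/-- The spatial Hessian of a time-dependent function. -/
def hessX {n : ℕ} (φ : Rn n × ℝ → ℝ) (q : Rn n × ℝ) : Matrix (Fin n) (Fin n) ℝ :=
  Matrix.of fun k j => fderiv ℝ (slopeX φ k) q (EuclideanSpace.single j 1, 0)

section Smooth

variable {n : ℕ} {φ : Rn n × ℝ → ℝ} {W : Set (Rn n × ℝ)}

theorem contDiffOn_slopeX (hW : IsOpen W) (hφ : ContDiffOn ℝ ∞ φ W) (k : Fin n) :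
    ContDiffOn ℝ ∞ (slopeX φ k) W :=
  (hφ.fderiv_of_isOpen hW (by simp)).clm_apply contDiffOn_const

theorem continuousOn_hessX (hW : IsOpen W) (hφ : ContDiffOn ℝ ∞ φ W) :
    ContinuousOn (hessX φ) W := by
  refine continuousOn_pi.2 fun k => continuousOn_pi.2 fun j => ?_
  exact (((contDiffOn_slopeX hW hφ k).fderiv_of_isOpen hW (m := ∞) (by simp)).clm_apply
    contDiffOn_const).continuousOn

/-- Symmetry of the full second derivative on space-time, restricted to spatial directions. It is
what makes $FG^{-1}F$ a positive semidefinite form. -/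
theorem hessX_transpose (hW : IsOpen W) (hφ : ContDiffOn ℝ ∞ φ W) {q : Rn n × ℝ} (hq : q ∈ W) :
    (hessX φ q)ᵀ = hessX φ q := by
  have hat : ContDiffAt ℝ ∞ φ q := hφ.contDiffAt (hW.mem_nhds hq)
  have hsymm : IsSymmSndFDerivAt ℝ φ q := hat.isSymmSndFDerivAt (by
    rw [minSmoothness_of_isRCLikeNormedField]; exact WithTop.coe_le_coe.2 le_top)
  have hd : DifferentiableAt ℝ (fderiv ℝ φ) q :=
    ((hat.fderiv_right (m := ∞) (by simp)).differentiableAt (by simp))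
  have key : ∀ k j, hessX φ q k j = fderiv ℝ (fderiv ℝ φ) q (EuclideanSpace.single j 1, 0)
      (EuclideanSpace.single k 1, 0) := by
    intro k j
    simp only [hessX, Matrix.of_apply]
    have : HasFDerivAt (slopeX φ k) _ q := hd.hasFDerivAt.clm_apply (hasFDerivAt_const _ q)
    rw [this.fderiv]
    simp
  ext j k
  rw [transpose_apply, key, key]
  exact hsymm _ _

theorem fderiv_slopeX_apply (k : Fin n) (q : Rn n × ℝ) (ξ : Rn n) :
    fderiv ℝ (slopeX φ k) q (ξ, 0) = (hessX φ q *ᵥ ξ.ofLp) k := by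
  have hξ : ((ξ, 0) : Rn n × ℝ) =
      ∑ j, ξ j • ((EuclideanSpace.single j 1, 0) : Rn n × ℝ) := by
    refine Prod.ext ?_ ?_
    · rw [Prod.fst_sum]
      have h := (EuclideanSpace.basisFun (Fin n) ℝ).sum_repr ξ
      simpa using h.symm
    · simp [Prod.snd_sum]
  rw [hξ, map_sum]
  simp only [map_smul, mulVec, dotProduct, hessX, smul_eq_mul, of_apply, mul_comm]

/-- Along the parabolic curve `s ↦ (x₀ + s ξ, T' - s²)` only the Hessian contributes to the
difference quotient of a spatial derivative. -/
theorem tendsto_slopeX_parabolic (hW : IsOpen W) (hφ : ContDiffOn ℝ ∞ φ W) {x0 : Rn n} {T' : ℝ}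
    (hq : (x0, T') ∈ W) (k : Fin n) (ξ : Rn n) :
    Tendsto (fun t => (√(T' - t))⁻¹ * (slopeX φ k (x0 + √(T' - t) • ξ, t) - slopeX φ k (x0, T')))
      (𝓝[<] T') (𝓝 ((hessX φ (x0, T') *ᵥ ξ.ofLp) k)) := by
  have hd : DifferentiableAt ℝ (slopeX φ k) (x0, T') :=
    ((contDiffOn_slopeX hW hφ k).contDiffAt (hW.mem_nhds hq)).differentiableAt (by simp)
  have hγ1 : HasDerivAt (fun s : ℝ => x0 + s • ξ) ξ 0 := by
    simpa using ((hasDerivAt_id (0 : ℝ)).smul_const ξ).const_add x0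
  have hγ2 : HasDerivAt (fun s : ℝ => T' - s ^ 2) 0 0 := by
    simpa using ((hasDerivAt_pow 2 (0 : ℝ)).const_sub T')
  have hγ : HasDerivAt (fun s : ℝ => (x0 + s • ξ, T' - s ^ 2)) (ξ, 0) 0 := hγ1.prodMk hγ2
  have hd' : HasFDerivAt (slopeX φ k) (fderiv ℝ (slopeX φ k) (x0, T'))
      ((fun s : ℝ => (x0 + s • ξ, T' - s ^ 2)) 0) := by
    simpa using hd.hasFDerivAt
  have hc := hd'.comp_hasDerivAt (0 : ℝ) hγ
  rw [hasDerivAt_iff_tendsto_slope_zero, fderiv_slopeX_apply] at hc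
  -- Substituting $s=\sqrt{T'-t}$, nonzero for $t<T'$, turns the curve into
  -- $t\mapsto(x_0+\sqrt{T'-t}\,\xi,\,t)$.
  have hs : Tendsto (fun t : ℝ => √(T' - t)) (𝓝[<] T') (𝓝[≠] 0) :=
    (tendsto_sqrt_sub T').mono_right (nhdsWithin_mono _ fun x hx => ne_of_gt hx)
  refine (hc.comp hs).congr' ?_
  filter_upwards [self_mem_nhdsWithin] with t ht
  have hτ : 0 ≤ T' - t := (sub_pos.2 ht).le
  simp [Function.comp, Real.sq_sqrt hτ]

end Smooth

/-! ### The limit of the integral over the base. -/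

theorem continuousOn_matrix_inv {α : Type*} [TopologicalSpace α] {n : ℕ} {s : Set α}
    {G : α → Matrix (Fin n) (Fin n) ℝ} (hG : ContinuousOn G s) (h : ∀ x ∈ s, (G x).det ≠ 0) :
    ContinuousOn (fun x => (G x)⁻¹) s := by
  simp only [Matrix.inv_def, Ring.inverse_eq_inv']
  have hdet : ContinuousOn (fun x => (G x).det) s :=
    (Continuous.matrix_det continuous_id).comp_continuousOn hG
  exact (hdet.inv₀ h).smul ((Continuous.matrix_adjugate continuous_id).comp_continuousOn hG)

theorem continuousOn_quadratic {α : Type*} [TopologicalSpace α] {n : ℕ} {s : Set α}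
    {G : α → Matrix (Fin n) (Fin n) ℝ} {v : α → Fin n → ℝ} (hG : ContinuousOn G s)
    (hv : ContinuousOn v s) : ContinuousOn (fun x => v x ⬝ᵥ G x *ᵥ v x) s := by
  have : Continuous fun q : Matrix (Fin n) (Fin n) ℝ × (Fin n → ℝ) => q.2 ⬝ᵥ q.1 *ᵥ q.2 :=
    continuous_snd.dotProduct (continuous_fst.matrix_mulVec continuous_snd)
  exact this.comp_continuousOn (hG.prodMk hv)

/-- The norm of the position section in the real coordinates of a semi-flat chart. -/
def posNormX {n : ℕ} (G : Rn n → Matrix (Fin n) (Fin n) ℝ) (φ : Rn n × ℝ → ℝ) (x0 : Rn n) (T' : ℝ)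
    (x : Rn n) (t : ℝ) : ℝ :=
  √((fun k => 2 * (x k - x0 k)) ⬝ᵥ G x *ᵥ (fun k => 2 * (x k - x0 k)) +
    (fun k => 1 / 2 * (slopeX φ k (x, t) - slopeX φ k (x0, T'))) ⬝ᵥ (G x)⁻¹ *ᵥ
      (fun k => 1 / 2 * (slopeX φ k (x, t) - slopeX φ k (x0, T'))))

/-- The density of the measure of `e^{-φ}` in the real coordinates of a semi-flat chart. -/
def densityX {n : ℕ} (G : Rn n → Matrix (Fin n) (Fin n) ℝ) (φ : Rn n × ℝ → ℝ)
    (x : Rn n) (t : ℝ) : ℝ :=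
  graphDensity (G x) ((1 / 4 : ℝ) • hessX φ (x, t))

section Core

variable {n : ℕ} {r lam a b T' : ℝ} {x0 : Rn n} {G : Rn n → Matrix (Fin n) (Fin n) ℝ}
  {φ : Rn n × ℝ → ℝ}

theorem quadratic_nonneg {A : Matrix (Fin n) (Fin n) ℝ} (hA : A.PosDef) (v : Fin n → ℝ) :
    0 ≤ v ⬝ᵥ A *ᵥ v := by
  simpa using hA.posSemidef.dotProduct_mulVec_nonneg v

theorem posNormX_sq (hGpos : ∀ x ∈ Metric.ball (0 : Rn n) r, (G x).PosDef) {x : Rn n}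
    (hx : x ∈ Metric.ball (0 : Rn n) r) (t : ℝ) :
    posNormX G φ x0 T' x t ^ 2 =
      (fun k => 2 * (x k - x0 k)) ⬝ᵥ G x *ᵥ (fun k => 2 * (x k - x0 k)) +
    (fun k => 1 / 2 * (slopeX φ k (x, t) - slopeX φ k (x0, T'))) ⬝ᵥ (G x)⁻¹ *ᵥ
      (fun k => 1 / 2 * (slopeX φ k (x, t) - slopeX φ k (x0, T'))) :=
  Real.sq_sqrt (add_nonneg (quadratic_nonneg (hGpos x hx) _) (quadratic_nonneg (hGpos x hx).inv _))

/-- The cotangent part of the norm is nonnegative and is dropped. The bound serves both the Gaussian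
majorant and the support of the cut-off. -/
theorem le_posNormX (hGpos : ∀ x ∈ Metric.ball (0 : Rn n) r, (G x).PosDef)
    (hGlow : ∀ x ∈ Metric.ball (0 : Rn n) r, ∀ v : Rn n,
      lam ^ 2 * ‖v‖ ^ 2 ≤ v.ofLp ⬝ᵥ G x *ᵥ v.ofLp)
    {x : Rn n} (hx : x ∈ Metric.ball (0 : Rn n) r) (t : ℝ) :
    2 * lam * ‖x - x0‖ ≤ posNormX G φ x0 T' x t := by
  refine le_of_sq_le_sq ?_ (Real.sqrt_nonneg _)
  rw [posNormX_sq hGpos hx]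
  have h1 := hGlow x hx ((2 : ℝ) • (x - x0))
  have h2 : ((2 : ℝ) • (x - x0)).ofLp = fun k => 2 * (x k - x0 k) := by ext k; simp
  rw [h2, norm_smul, Real.norm_of_nonneg (by norm_num : (0 : ℝ) ≤ 2)] at h1
  have h3 := quadratic_nonneg (hGpos x hx).inv
    (fun k => 1 / 2 * (slopeX φ k (x, t) - slopeX φ k (x0, T')))
  nlinarith

theorem continuousOn_posNormX (hGc : ContinuousOn G (Metric.ball 0 r))
    (hGpos : ∀ x ∈ Metric.ball (0 : Rn n) r, (G x).PosDef)
    (hφ : ContDiffOn ℝ ∞ φ (Metric.ball 0 r ×ˢ Ioo a b)) :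
    ContinuousOn (Function.uncurry (posNormX G φ x0 T')) (Metric.ball 0 r ×ˢ Ioo a b) := by
  have hW : IsOpen (Metric.ball (0 : Rn n) r ×ˢ Ioo a b) := Metric.isOpen_ball.prod isOpen_Ioo
  have hG' : ContinuousOn (fun q : Rn n × ℝ => G q.1) (Metric.ball 0 r ×ˢ Ioo a b) :=
    hGc.comp continuousOn_fst fun q hq => hq.1
  have hGi : ContinuousOn (fun q : Rn n × ℝ => (G q.1)⁻¹) (Metric.ball 0 r ×ˢ Ioo a b) :=
    continuousOn_matrix_inv hG' fun q hq => (hGpos q.1 hq.1).det_pos.ne'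
  refine Real.continuous_sqrt.comp_continuousOn (ContinuousOn.add ?_ ?_)
  · refine continuousOn_quadratic hG' (Continuous.continuousOn ?_)
    fun_prop
  · refine continuousOn_quadratic hGi (continuousOn_pi.2 fun k => ?_)
    exact continuousOn_const.mul
      (((contDiffOn_slopeX hW hφ k).continuousOn).sub continuousOn_const)

theorem continuousOn_densityX (hGc : ContinuousOn G (Metric.ball 0 r))
    (hφ : ContDiffOn ℝ ∞ φ (Metric.ball 0 r ×ˢ Ioo a b)) :
    ContinuousOn (Function.uncurry (densityX G φ)) (Metric.ball 0 r ×ˢ Ioo a b) := by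
  have hW : IsOpen (Metric.ball (0 : Rn n) r ×ˢ Ioo a b) := Metric.isOpen_ball.prod isOpen_Ioo
  have hG' : ContinuousOn (fun q : Rn n × ℝ => G q.1) (Metric.ball 0 r ×ˢ Ioo a b) :=
    hGc.comp continuousOn_fst fun q hq => hq.1
  have hH : ContinuousOn (fun q : Rn n × ℝ => (1 / 4 : ℝ) • hessX φ q)
      (Metric.ball 0 r ×ˢ Ioo a b) := (continuousOn_hessX hW hφ).const_smul (1 / 4 : ℝ)
  have h := continuous_graphDensity.comp_continuousOn (hG'.prodMk hH)
  exact h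

/-- Put $\tau=T'-t$. The two components of the position section are $2\sqrt\tau\,\xi$ and, by
`tendsto_slopeX_parabolic`, $2\sqrt\tau\,(F\xi+o(1))$ with $F=\frac14\mathrm{Hess}_x\phi$. Division
by $4\tau$ leaves $\xi^{\mathsf T}G\xi+(F\xi)^{\mathsf T}G^{-1}(F\xi)$, and symmetry of $F$ combines
the terms into one quadratic form. -/
theorem tendsto_posNormX_parabolic (hx0 : x0 ∈ Metric.ball (0 : Rn n) r) (hT' : T' ∈ Ioo a b)
    (hGc : ContinuousOn G (Metric.ball 0 r))
    (hGpos : ∀ x ∈ Metric.ball (0 : Rn n) r, (G x).PosDef)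
    (hφ : ContDiffOn ℝ ∞ φ (Metric.ball 0 r ×ˢ Ioo a b)) (ξ : Rn n) :
    Tendsto (fun t => posNormX G φ x0 T' (x0 + √(T' - t) • ξ) t ^ 2 / (4 * (T' - t))) (𝓝[<] T')
      (𝓝 (ξ.ofLp ⬝ᵥ (G x0 + ((1 / 4 : ℝ) • hessX φ (x0, T')) * (G x0)⁻¹ *
        ((1 / 4 : ℝ) • hessX φ (x0, T'))) *ᵥ ξ.ofLp)) := by
  have hW : IsOpen (Metric.ball (0 : Rn n) r ×ˢ Ioo a b) := Metric.isOpen_ball.prod isOpen_Ioo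
  have hq : (x0, T') ∈ Metric.ball (0 : Rn n) r ×ˢ Ioo a b := ⟨hx0, hT'⟩
  set F : Matrix (Fin n) (Fin n) ℝ := (1 / 4 : ℝ) • hessX φ (x0, T') with hF
  have hFt : Fᵀ = F := by rw [hF, transpose_smul, hessX_transpose hW hφ hq]
  have hcurve : Tendsto (fun t => x0 + √(T' - t) • ξ) (𝓝[<] T') (𝓝 x0) := by
    have : Continuous fun t : ℝ => x0 + √(T' - t) • ξ := by fun_prop
    have h := this.tendsto T'
    simp only [sub_self, Real.sqrt_zero, zero_smul, add_zero] at h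
    exact h.mono_left nhdsWithin_le_nhds
  have hball : Metric.ball (0 : Rn n) r ∈ 𝓝 x0 := Metric.isOpen_ball.mem_nhds hx0
  have hGl : Tendsto (fun t => G (x0 + √(T' - t) • ξ)) (𝓝[<] T') (𝓝 (G x0)) :=
    (hGc.continuousAt hball).tendsto.comp hcurve
  have hGil : Tendsto (fun t => (G (x0 + √(T' - t) • ξ))⁻¹) (𝓝[<] T') (𝓝 (G x0)⁻¹) :=
    ((continuousOn_matrix_inv hGc fun x hx => (hGpos x hx).det_pos.ne').continuousAt
      hball).tendsto.comp hcurve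
  have hquad : Continuous fun q : Matrix (Fin n) (Fin n) ℝ × (Fin n → ℝ) => q.2 ⬝ᵥ q.1 *ᵥ q.2 :=
    continuous_snd.dotProduct (continuous_fst.matrix_mulVec continuous_snd)
  have hul : Tendsto (fun t k => (1 / 4 : ℝ) * ((√(T' - t))⁻¹ *
      (slopeX φ k (x0 + √(T' - t) • ξ, t) - slopeX φ k (x0, T')))) (𝓝[<] T')
      (𝓝 (F *ᵥ ξ.ofLp)) := by
    refine tendsto_pi_nhds.2 fun k => ?_
    have h := (tendsto_slopeX_parabolic hW hφ hq k ξ).const_mul (1 / 4)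
    rw [hF, smul_mulVec]
    exact h
  have h1 := (hquad.tendsto _).comp (hGl.prodMk_nhds (tendsto_const_nhds (x := ξ.ofLp)))
  have h2 := (hquad.tendsto _).comp (hGil.prodMk_nhds hul)
  have hval : ξ.ofLp ⬝ᵥ (G x0 + F * (G x0)⁻¹ * F) *ᵥ ξ.ofLp =
      ξ.ofLp ⬝ᵥ G x0 *ᵥ ξ.ofLp + (F *ᵥ ξ.ofLp) ⬝ᵥ (G x0)⁻¹ *ᵥ (F *ᵥ ξ.ofLp) := by
    rw [add_mulVec, dotProduct_add, mul_assoc, ← mulVec_mulVec, ← mulVec_mulVec,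
      dotProduct_mulVec ξ.ofLp F, ← mulVec_transpose, hFt]
  rw [hval]
  refine (h1.add h2).congr' ?_
  filter_upwards [self_mem_nhdsWithin, hcurve.eventually_mem hball] with t ht htb
  have hτ : 0 < T' - t := sub_pos.2 ht
  have hs : 0 < √(T' - t) := Real.sqrt_pos.2 hτ
  have hss : √(T' - t) ^ 2 = T' - t := Real.sq_sqrt hτ.le
  rw [posNormX_sq hGpos htb]
  simp only [Function.comp]
  set s := √(T' - t)
  rw [← hss]
  -- Both components carry the factor $2s$, whose square cancels the denominator $4(T'-t)=4s^2$.
  have e1 : (fun k => 2 * ((x0 + s • ξ) k - x0 k)) = (2 * s) • ξ.ofLp := by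
    ext k; simp; ring
  have e2 : (fun k => 1 / 2 * (slopeX φ k (x0 + s • ξ, t) - slopeX φ k (x0, T'))) =
      (2 * s) • fun k => (1 / 4 : ℝ) * (s⁻¹ *
        (slopeX φ k (x0 + s • ξ, t) - slopeX φ k (x0, T'))) := by
    ext k; simp; field_simp; ring
  rw [e1, e2]
  simp only [mulVec_smul, smul_dotProduct, dotProduct_smul, smul_eq_mul]
  field_simp
  ring

/-- The limit of the localized heat-kernel integral over the base of a semi-flat chart. -/
theorem tendsto_base_integral (hlam : 0 < lam) (hr : 0 < r)
    (hx0 : x0 ∈ Metric.ball (0 : Rn n) (r / 4)) (hT' : T' ∈ Ioo a b) {f : ℝ → ℝ}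
    (hf : IsCutoff f) (hGc : ContinuousOn G (Metric.ball 0 r))
    (hGpos : ∀ x ∈ Metric.ball (0 : Rn n) r, (G x).PosDef)
    (hGlow : ∀ x ∈ Metric.ball (0 : Rn n) r, ∀ v : Rn n,
      lam ^ 2 * ‖v‖ ^ 2 ≤ v.ofLp ⬝ᵥ G x *ᵥ v.ofLp)
    (hφ : ContDiffOn ℝ ∞ φ (Metric.ball 0 r ×ˢ Ioo a b)) :
    Tendsto (fun t => ∫ x in Metric.ball (0 : Rn n) r,
        (1 / (4 * Real.pi * (T' - t)) ^ ((n : ℝ) / 2)) *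
          Real.exp (-(posNormX G φ x0 T' x t) ^ 2 / (4 * (T' - t))) *
          f (4 * posNormX G φ x0 T' x t / (lam * r)) * densityX G φ x t)
      (𝓝[<] T') (𝓝 (√(G x0).det / 2 ^ n)) := by
  have hW : IsOpen (Metric.ball (0 : Rn n) r ×ˢ Ioo a b) := Metric.isOpen_ball.prod isOpen_Ioo
  have hx0r : x0 ∈ Metric.ball (0 : Rn n) r := Metric.ball_subset_ball (by linarith) hx0
  have hP0 : posNormX G φ x0 T' x0 T' = 0 := by
    simp [posNormX, dotProduct]
  have h := tendsto_gaussian_concentration hlam hr hx0 hT'.1 hT'.2 hf.smooth.continuous hf.range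
    (hf.eq_one 0 zero_le_one) hf.eq_zero (continuousOn_posNormX hGc hGpos hφ)
    (continuousOn_densityX hGc hφ) (fun x hx t _ => le_posNormX hGpos hGlow hx t) hP0
    (tendsto_posNormX_parabolic hx0r hT' hGc hGpos hφ)
  convert h using 2
  set F : Matrix (Fin n) (Fin n) ℝ := (1 / 4 : ℝ) • hessX φ (x0, T') with hF
  have hq : (x0, T') ∈ Metric.ball (0 : Rn n) r ×ˢ Ioo a b := ⟨hx0r, hT'⟩
  have hFt : Fᵀ = F := by rw [hF, transpose_smul, hessX_transpose hW hφ hq]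
  have hA := posDef_graph (hGpos x0 hx0r) hFt
  have hdG := (hGpos x0 hx0r).det_pos
  have hs := Real.sqrt_pos.2 hA.det_pos
  have hpi : 0 < Real.pi ^ ((n : ℝ) / 2) := by positivity
  have h4 : (4 : ℝ) ^ ((n : ℝ) / 2) = 2 ^ n := by
    rw [show (4 : ℝ) = 2 ^ (2 : ℝ) by norm_num, ← Real.rpow_mul (by norm_num),
      mul_div_cancel₀ _ (by norm_num), Real.rpow_natCast]
  -- The factors $\pi^{n/2}$ and $\sqrt{\det(G+FG^{-1}F)}$ cancel; what remains of $(4\pi)^{n/2}$ is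
  -- $4^{n/2}=2^n$.
  rw [integral_exp_neg_quadratic hA, densityX, ← hF, graphDensity_eq (hGpos x0 hx0r),
    Real.sqrt_mul hdG.le, Real.mul_rpow (by norm_num) Real.pi_pos.le, h4]
  field_simp

end Core

/-! ### Functions of $x$ alone on a tube domain. -/

section Coordinates

variable {n : ℕ}

/-- `xPart` as a real-linear map. -/
def xPartL (n : ℕ) : Cn n →L[ℝ] Rn n :=
  LinearMap.toContinuousLinearMap
    { toFun := xPart
      map_add' := fun z w => by ext i; simp [xPart]
      map_smul' := fun c z => by ext i; simp [xPart] }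

/-- `x ↦ x + i 0` as a real-linear map. -/
def ofXL (n : ℕ) : Rn n →L[ℝ] Cn n :=
  LinearMap.toContinuousLinearMap
    { toFun := fun x => mkC x 0
      map_add' := fun z w => by ext i; simp [mkC]
      map_smul' := fun c z => by ext i; simp [mkC] }

/-- `y ↦ 0 + i y` as a real-linear map. -/
def ofYL (n : ℕ) : Rn n →L[ℝ] Cn n :=
  LinearMap.toContinuousLinearMap
    { toFun := fun y => mkC 0 y
      map_add' := fun z w => by ext i; simp [mkC, add_mul]
      map_smul' := fun c z => by ext i; simp [mkC, mul_assoc] }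

theorem xPartL_apply (z : Cn n) : xPartL n z = xPart z := rfl

theorem ofYL_apply (y : Rn n) : ofYL n y = mkC 0 y := rfl

theorem xPart_mkC (x y : Rn n) : xPart (mkC x y) = x := by
  ext i; simp [xPart, mkC]

theorem yPart_mkC (x y : Rn n) : yPart (mkC x y) = y := by
  ext i; simp [yPart, mkC]

theorem mkC_xPart_yPart (z : Cn n) : mkC (xPart z) (yPart z) = z := by
  ext i; simp [xPart, yPart, mkC]

theorem mkC_eq_add (x y : Rn n) : mkC x y = mkC x 0 + ofYL n y := by
  ext i; simp [ofYL_apply, mkC]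

theorem ofYL_eq_sum (y : Rn n) :
    ofYL n y = ∑ k, y k • (EuclideanSpace.single k Complex.I : Cn n) := by
  ext i
  simp [ofYL_apply, mkC, Finset.sum_apply, Pi.single_apply]

/-- The tube domain `B(r) + i B(r')`. -/
def tube (n : ℕ) (r r' : ℝ) : Set (Cn n) :=
  {z | xPart z ∈ Metric.ball (0 : Rn n) r ∧ yPart z ∈ Metric.ball (0 : Rn n) r'}

theorem mkC_mem_tube {r r' : ℝ} {x y : Rn n} (hx : x ∈ Metric.ball (0 : Rn n) r)
    (hy : y ∈ Metric.ball (0 : Rn n) r') : mkC x y ∈ tube n r r' := by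
  exact ⟨by rwa [xPart_mkC], by rwa [yPart_mkC]⟩

/-- The vectors $i e_k$ span the fibre directions over $\mathbb R$, so the derivative along the
fibre is zero; the fibre is a ball, hence connected, and contains $y=0$. -/
theorem eq_mkC_zero_of_dY_eq_zero {V : Type*} [NormedAddCommGroup V] [NormedSpace ℝ V] {r r' : ℝ}
    (hr' : 0 < r') (hopen : IsOpen (tube n r r')) {F : Cn n → V}
    (hF : DifferentiableOn ℝ F (tube n r r')) (hY : ∀ z ∈ tube n r r', ∀ k, dY k F z = 0)
    {z : Cn n} (hz : z ∈ tube n r r') : F z = F (mkC (xPart z) 0) := by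
  have hd : ∀ y ∈ Metric.ball (0 : Rn n) r',
      HasFDerivAt (fun y => F (mkC (xPart z) y)) (0 : Rn n →L[ℝ] V) y := by
    intro y hy
    have hmem := mkC_mem_tube hz.1 hy
    have h1 : HasFDerivAt (fun y => mkC (xPart z) y) (ofYL n) y := by
      rw [funext (mkC_eq_add (xPart z))]
      exact (ofYL n).hasFDerivAt.const_add _
    have h2 := ((hF.differentiableAt (hopen.mem_nhds hmem)).hasFDerivAt).comp y h1
    have h0 : (fderiv ℝ F (mkC (xPart z) y)).comp (ofYL n) = 0 := by
      refine ContinuousLinearMap.ext fun η => ?_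
      rw [ContinuousLinearMap.comp_apply, ofYL_eq_sum, map_sum, _root_.zero_apply]
      refine Finset.sum_eq_zero fun k _ => ?_
      have := hY _ hmem k
      rw [dY] at this
      rw [map_smul, this, smul_zero]
    rw [h0] at h2
    exact h2
  have hconst := Metric.isOpen_ball.is_const_of_fderiv_eq_zero (𝕜 := ℝ)
    (convex_ball (0 : Rn n) r').isPreconnected
    (fun y hy => (hd y hy).differentiableAt.differentiableWithinAt) (fun y hy => (hd y hy).fderiv)
    hz.2 (Metric.mem_ball_self hr')
  simpa only [mkC_xPart_yPart] using hconst

/-- Equality near $z$ suffices, as is needed for functions that depend on $x$ alone only inside the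
tube. -/
theorem dX_dY_comp_xPart {V : Type*} [NormedAddCommGroup V] [NormedSpace ℝ V] {u : Cn n → V}
    {A : Rn n → V} {A' : Rn n →L[ℝ] V} {z : Cn n} (h : u =ᶠ[𝓝 z] fun w => A (xPart w))
    (hA : HasFDerivAt A A' (xPart z)) (k : Fin n) :
    dX k u z = A' (EuclideanSpace.single k 1) ∧ dY k u z = 0 := by
  have h1 : HasFDerivAt (fun w => A (xPart w)) (A'.comp (xPartL n)) z :=
    HasFDerivAt.comp (g := A) z hA (xPartL n).hasFDerivAt
  have h2 := (h.hasFDerivAt_iff.2 h1).fderiv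
  have e1 : xPart (EuclideanSpace.single k (1 : ℂ)) = EuclideanSpace.single k (1 : ℝ) := by
    ext i
    by_cases hi : i = k <;> simp [xPart, hi]
  have e2 : xPart (EuclideanSpace.single k Complex.I) = 0 := by
    ext i
    by_cases hi : i = k <;> simp [xPart, hi]
  constructor
  · rw [dX, h2, ContinuousLinearMap.comp_apply, xPartL_apply, e1]
  · rw [dY, h2, ContinuousLinearMap.comp_apply, xPartL_apply, e2, map_zero]

/-- On functions of $x$ both $\partial_z$ and $\partial_{\bar z}$ act as $\frac12\partial_x$; this
is the origin of the factor $\frac14$. The first derivative is required on all of $\Omega$ so that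
it can be differentiated again at $z$. -/
theorem curv_comp_xPart {Ω : Set (Cn n)} (hΩ : IsOpen Ω) {u : Cn n → ℝ} {A : Rn n → ℝ}
    {A' : Rn n → Rn n →L[ℝ] ℝ} {B' : Fin n → Rn n →L[ℝ] ℝ} {z : Cn n} (hz : z ∈ Ω)
    (hu : ∀ w ∈ Ω, u w = A (xPart w)) (hA : ∀ w ∈ Ω, HasFDerivAt A (A' (xPart w)) (xPart w))
    (hB : ∀ k, HasFDerivAt (fun x => A' x (EuclideanSpace.single k 1)) (B' k) (xPart z)) :
    curv u z = (Matrix.of fun k j => 1 / 4 * B' k (EuclideanSpace.single j 1)).map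
      Complex.ofReal := by
  ext k j
  have hbar : dZbar k (fun w => (u w : ℂ)) =ᶠ[𝓝 z]
      fun w => ((1 / 2 * A' (xPart w) (EuclideanSpace.single k 1) : ℝ) : ℂ) := by
    filter_upwards [hΩ.mem_nhds hz] with w hw
    have he : (fun w => (u w : ℂ)) =ᶠ[𝓝 w] fun w => (A (xPart w) : ℂ) := by
      filter_upwards [hΩ.mem_nhds hw] with v hv
      rw [hu v hv]
    obtain ⟨h1, h2⟩ := dX_dY_comp_xPart (A := fun x => (A x : ℂ)) he
      (Complex.ofRealCLM.hasFDerivAt.comp _ (hA w hw)) k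
    rw [dZbar, h1, h2]
    simp
  obtain ⟨h1, h2⟩ := dX_dY_comp_xPart
    (A := fun x => ((1 / 2 * A' x (EuclideanSpace.single k 1) : ℝ) : ℂ)) hbar
      (Complex.ofRealCLM.hasFDerivAt.comp _ ((hB k).const_mul (1 / 2))) j
  simp only [curv, Matrix.of_apply, Matrix.map_apply]
  rw [dZ, h1, h2]
  simp
  ring

end Coordinates

/-! ### From a lower eigenvalue bound to positivity. -/

section Eigenvalues

variable {n : ℕ}

/-- A real symmetric matrix all of whose eigenvalues are at least `c` is bounded below by `c`. -/
theorem mul_norm_sq_le_quadratic {G : Matrix (Fin n) (Fin n) ℝ} (hG : Gᵀ = G) {c : ℝ}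
    (hc : ∀ μ : ℝ, Module.End.HasEigenvalue (Matrix.toLin' (G.map Complex.ofReal)) (μ : ℂ) → c ≤ μ)
    (v : Rn n) : c * ‖v‖ ^ 2 ≤ v.ofLp ⬝ᵥ G *ᵥ v.ofLp := by
  have hH : (G - c • (1 : Matrix (Fin n) (Fin n) ℝ)).IsHermitian := by
    rw [Matrix.IsHermitian, conjTranspose_eq_transpose_of_trivial, transpose_sub, hG,
      transpose_smul, transpose_one]
  have hpos : (G - c • (1 : Matrix (Fin n) (Fin n) ℝ)).PosSemidef := by
    rw [hH.posSemidef_iff_eigenvalues_nonneg]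
    intro i
    have hev := hH.mulVec_eigenvectorBasis i
    have hne : (hH.eigenvectorBasis i).ofLp ≠ 0 := by
      intro h0
      have h1 := hH.eigenvectorBasis.orthonormal.1 i
      have h2 : hH.eigenvectorBasis i = 0 := by ext j; simp [h0]
      rw [h2, norm_zero] at h1
      exact zero_ne_one h1
    set w := (hH.eigenvectorBasis i).ofLp
    have hGw : G *ᵥ w = (hH.eigenvalues i + c) • w := by
      rw [sub_mulVec, smul_mulVec, one_mulVec] at hev
      rw [add_smul, ← hev, sub_add_cancel]
    have : c ≤ hH.eigenvalues i + c := by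
      apply hc
      -- A real eigenvector, viewed in $\mathbb C^n$, is an eigenvector of the complexified matrix,
      -- to which the bound `hc` refers.
      refine Module.End.hasEigenvalue_of_hasEigenvector (x := fun j => (w j : ℂ)) ⟨?_, ?_⟩
      · rw [Module.End.mem_eigenspace_iff, Matrix.toLin'_apply]
        ext j
        have := congrArg (Complex.ofReal) (congrFun hGw j)
        simpa [mulVec, dotProduct] using this
      · intro h0
        apply hne
        ext j
        simpa using congrFun h0 j
    simpa using this
  have h := hpos.dotProduct_mulVec_nonneg v.ofLp
  rw [sub_mulVec, dotProduct_sub, smul_mulVec, one_mulVec, dotProduct_smul] at h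
  have hn : v.ofLp ⬝ᵥ v.ofLp = ‖v‖ ^ 2 := by
    rw [EuclideanSpace.norm_sq_eq]
    simp [dotProduct, sq]
  simp only [star_trivial, hn, smul_eq_mul] at h
  linarith

theorem posDef_of_le_quadratic {G : Matrix (Fin n) (Fin n) ℝ} (hG : Gᵀ = G) {c : ℝ} (hc : 0 < c)
    (h : ∀ v : Rn n, c * ‖v‖ ^ 2 ≤ v.ofLp ⬝ᵥ G *ᵥ v.ofLp) : G.PosDef := by
  refine Matrix.PosDef.of_dotProduct_mulVec_pos
    (by rw [Matrix.IsHermitian, conjTranspose_eq_transpose_of_trivial, hG]) fun {x} hx => ?_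
  have h1 := h (WithLp.toLp 2 x)
  have h2 : 0 < ‖(WithLp.toLp 2 x : Rn n)‖ := by
    rw [norm_pos_iff]
    intro h0
    exact hx (by simpa using congrArg WithLp.ofLp h0)
  rw [star_trivial]
  exact lt_of_lt_of_le (by positivity) h1

end Eigenvalues

/-! ### The semi-flat metric as a real matrix on the base, and the fibre volume. -/

section SemiFlat

variable {n : ℕ} {X : Type*} [TopologicalSpace X] [ChartedSpace (Cn n) X]
  {g : KahlerMetric n X} {U : Set X} {r r' : ℝ} {ψ : OpenPartialHomeomorph X (Cn n)}

/-- The real matrix of a semi-flat metric over the base. -/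
def baseMat (g : KahlerMetric n X) (ψ : OpenPartialHomeomorph X (Cn n)) (x : Rn n) :
    Matrix (Fin n) (Fin n) ℝ :=
  (g.mat ψ (mkC x 0)).map Complex.re

theorem IsSemiFlat.target_eq_tube (hψ : IsSemiFlat g U r r' ψ) : ψ.target = tube n r r' :=
  hψ.target_eq

theorem IsSemiFlat.isOpen_tube (hψ : IsSemiFlat g U r r' ψ) : IsOpen (tube n r r') :=
  hψ.target_eq_tube ▸ ψ.open_target

/-- Independence of $y$ moves the point to $y=0$; there the matrix is Hermitian and symmetric, so
its entries are real. -/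
theorem IsSemiFlat.mat_eq (hψ : IsSemiFlat g U r r' ψ) (hr' : 0 < r') {z : Cn n}
    (hz : z ∈ tube n r r') : g.mat ψ z = (baseMat g ψ (xPart z)).map Complex.ofReal := by
  have hopen := hψ.isOpen_tube
  have htar := hψ.target_eq_tube
  ext i j
  have hd : DifferentiableOn ℝ (fun w => g.mat ψ w i j) (tube n r r') := by
    rw [← htar]
    exact (g.smooth ψ hψ.mem_atlas i j).differentiableOn (by simp)
  have h1 := eq_mkC_zero_of_dY_eq_zero hr' hopen hd
    (fun w hw k => hψ.coeff_y w (htar ▸ hw) i j k) hz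
  have hmem : mkC (xPart z) 0 ∈ ψ.target :=
    htar ▸ mkC_mem_tube hz.1 (Metric.mem_ball_self hr')
  have h2 : starRingEnd ℂ (g.mat ψ (mkC (xPart z) 0) i j) = g.mat ψ (mkC (xPart z) 0) i j :=
    (g.conj_symm _ _ _).trans (hψ.coeff_symm _ hmem j i)
  simp only [h1, Matrix.map_apply, baseMat]
  exact (Complex.conj_eq_iff_re.1 h2).symm

theorem IsSemiFlat.baseMat_transpose (hψ : IsSemiFlat g U r r' ψ) (hr' : 0 < r') {x : Rn n}
    (hx : x ∈ Metric.ball (0 : Rn n) r) : (baseMat g ψ x)ᵀ = baseMat g ψ x := by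
  ext i j
  have hmem : mkC x 0 ∈ ψ.target :=
    hψ.target_eq_tube ▸ mkC_mem_tube hx (Metric.mem_ball_self hr')
  simp only [transpose_apply, baseMat, Matrix.map_apply, hψ.coeff_symm _ hmem j i]

theorem IsSemiFlat.continuousOn_baseMat (hψ : IsSemiFlat g U r r' ψ) (hr' : 0 < r') :
    ContinuousOn (baseMat g ψ) (Metric.ball 0 r) := by
  refine continuousOn_pi.2 fun i => continuousOn_pi.2 fun j => ?_
  have h := (g.smooth ψ hψ.mem_atlas i j).continuousOn
  rw [hψ.target_eq_tube] at h
  exact Complex.continuous_re.comp_continuousOn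
    (h.comp (ofXL n).continuous.continuousOn fun x hx => mkC_mem_tube hx (Metric.mem_ball_self hr'))

theorem IsSemiFlat.lam_sq_le (hψ : IsSemiFlat g U r r' ψ) (hr' : 0 < r') (hlam : 0 < lam g ψ)
    {x : Rn n} (hx : x ∈ Metric.ball (0 : Rn n) r) (v : Rn n) :
    lam g ψ ^ 2 * ‖v‖ ^ 2 ≤ v.ofLp ⬝ᵥ baseMat g ψ x *ᵥ v.ofLp := by
  refine mul_norm_sq_le_quadratic (hψ.baseMat_transpose hr' hx) (fun μ hμ => ?_) v
  have hpos : 0 < sInf {μ : ℝ | ∃ z ∈ ψ.target,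
      Module.End.HasEigenvalue (Matrix.toLin' (g.mat ψ z)) (μ : ℂ)} := Real.sqrt_pos.1 hlam
  have hmem := mkC_mem_tube (r' := r') hx (Metric.mem_ball_self hr')
  rw [lam, Real.sq_sqrt hpos.le]
  refine csInf_le ?_ ⟨mkC x 0, hψ.target_eq_tube ▸ hmem, ?_⟩
  -- The infimum in `ℝ` of a set unbounded below is $0$ by convention, which positivity of `lam`
  -- excludes.
  · by_contra hb
    rw [Real.sInf_of_not_bddBelow hb] at hpos
    exact lt_irrefl _ hpos
  · rwa [hψ.mat_eq hr' hmem, xPart_mkC]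

theorem IsSemiFlat.posDef_baseMat (hψ : IsSemiFlat g U r r' ψ) (hr' : 0 < r')
    (hlam : 0 < lam g ψ) {x : Rn n} (hx : x ∈ Metric.ball (0 : Rn n) r) :
    (baseMat g ψ x).PosDef :=
  posDef_of_le_quadratic (hψ.baseMat_transpose hr' hx) (by positivity)
    (hψ.lam_sq_le hr' hlam hx)

/-- Here $\partial_{y^k}=i\,\partial_{x^k}$ and a sesquilinear form is unchanged when both arguments
are multiplied by $i$. -/
theorem riem_coordVec (g : KahlerMetric n X) (ψ : OpenPartialHomeomorph X (Cn n)) (z : Cn n)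
    (i j : Fin n) :
    g.riem (ψ.symm z) (coordVec ψ z (EuclideanSpace.single i Complex.I))
      (coordVec ψ z (EuclideanSpace.single j Complex.I)) = 2 * (g.mat ψ z i j).re := by
  have h : ∀ k : Fin n, coordVec ψ z (EuclideanSpace.single k Complex.I) =
      Complex.I • coordVec ψ z (EuclideanSpace.single k 1) := by
    intro k
    have : (EuclideanSpace.single k Complex.I : Cn n) =
        Complex.I • EuclideanSpace.single k (1 : ℂ) := by
      ext l
      by_cases hl : l = k <;> simp [hl]
    simp only [coordVec]
    rw [this]
    exact ContinuousLinearMap.map_smul _ _ _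
  have key : ∀ v w, g.form (ψ.symm z) (Complex.I • v) (Complex.I • w) = g.form (ψ.symm z) v w := by
    intro v w
    rw [LinearMap.map_smulₛₗ, LinearMap.map_smulₛₗ, LinearMap.smul_apply, smul_smul]
    simp
  rw [KahlerMetric.riem, h, h, key]
  rfl

/-- Along the fibre the Gram matrix of the $\partial_{y^i}$ is the constant matrix $2G(x_0)$, so the
volume density is constant. -/
theorem IsSemiFlat.fibreVol_eq (hψ : IsSemiFlat g U r r' ψ) (hr' : 0 < r') {z₀ : Cn n}
    (hz₀ : xPart z₀ ∈ Metric.ball (0 : Rn n) r) :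
    fibreVol g ψ r' z₀ = volume.real (Metric.ball (0 : Rn n) r') *
      (√2 ^ n * √(baseMat g ψ (xPart z₀)).det) := by
  have hval : ∀ y ∈ Metric.ball (0 : Rn n) r',
      √(Matrix.det (Matrix.of fun i j : Fin n =>
      g.riem (ψ.symm (mkC (xPart z₀) y))
        (coordVec ψ (mkC (xPart z₀) y) (EuclideanSpace.single i Complex.I))
        (coordVec ψ (mkC (xPart z₀) y) (EuclideanSpace.single j Complex.I)))) =
      √2 ^ n * √(baseMat g ψ (xPart z₀)).det := by
    intro y hy
    have hmat : (Matrix.of fun i j : Fin n =>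
        g.riem (ψ.symm (mkC (xPart z₀) y))
          (coordVec ψ (mkC (xPart z₀) y) (EuclideanSpace.single i Complex.I))
          (coordVec ψ (mkC (xPart z₀) y) (EuclideanSpace.single j Complex.I))) =
        (2 : ℝ) • baseMat g ψ (xPart z₀) := by
      ext i j
      rw [Matrix.of_apply, riem_coordVec, hψ.mat_eq hr' (mkC_mem_tube hz₀ hy), xPart_mkC]
      simp
    have h2 : √((2 : ℝ) ^ n) = √2 ^ n := by
      rw [Real.sqrt_eq_iff_eq_sq (by positivity) (by positivity), ← pow_mul, mul_comm, pow_mul,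
        Real.sq_sqrt (by norm_num)]
    rw [hmat, det_smul, Fintype.card_fin, Real.sqrt_mul (by positivity), h2]
  rw [fibreVol, setIntegral_congr_fun Metric.isOpen_ball.measurableSet hval, setIntegral_const,
    smul_eq_mul]

end SemiFlat

/-! ### The potential of a graphical family as a function on the base. -/

section Potential

variable {n : ℕ} {X : Type*} [TopologicalSpace X] [ChartedSpace (Cn n) X]
  {L : X → Type*} [TopologicalSpace (TotalSpace ℂ L)]
  [∀ x, AddCommGroup (L x)] [∀ x, Module ℂ (L x)] [∀ x, TopologicalSpace (L x)]
  [FiberBundle ℂ L]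
  {g : KahlerMetric n X} {U : Set X} {r r' : ℝ} {ψ : OpenPartialHomeomorph X (Cn n)}
  {T : EReal} {h : ℝ → HermitianMetric n L} {e : ∀ x, L x}

/-- The potential of a graphical family over the base. -/
def basePotential (h : ℝ → HermitianMetric n L) (ψ : OpenPartialHomeomorph X (Cn n))
    (e : ∀ x, L x) (q : Rn n × ℝ) : ℝ :=
  (h q.2).potential ψ e (mkC q.1 0)

theorem HermitianMetric.form_frame_ne_zero (k : HermitianMetric n L)
    (he : IsHolFrame n L e ψ.source) {z : Cn n} (hz : z ∈ ψ.target) :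
    (k.form (ψ.symm z) (e (ψ.symm z)) (e (ψ.symm z))).re ≠ 0 :=
  (k.pos _ _ (he.2 _ (ψ.map_target hz))).ne'

theorem IsSemiFlat.contDiffOn_basePotential (hψ : IsSemiFlat g U r r' ψ) (hr' : 0 < r')
    (hflow : IsLineBundleMCF g h T) (he : IsHolFrame n L e ψ.source) {I : Set ℝ}
    (hI : I ⊆ timeSet T) :
    ContDiffOn ℝ ∞ (basePotential h ψ e) (Metric.ball 0 r ×ˢ I) := by
  have hmem : ∀ x ∈ Metric.ball (0 : Rn n) r, mkC x 0 ∈ ψ.target := fun x hx =>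
    hψ.target_eq_tube ▸ mkC_mem_tube hx (Metric.mem_ball_self hr')
  have hs := hflow.smooth ψ hψ.mem_atlas ψ.source e ψ.open_source he
  have hmap : ContDiffOn ℝ ∞ (fun q : Rn n × ℝ => (ofXL n q.1, q.2)) (Metric.ball 0 r ×ˢ I) :=
    (((ofXL n).contDiff.comp contDiff_fst).prodMk contDiff_snd).contDiffOn
  have hc := hs.comp hmap fun q hq =>
    ⟨⟨hmem q.1 hq.1, ψ.map_target (hmem q.1 hq.1)⟩, hI hq.2⟩
  exact (hc.log fun q hq => (h q.2).form_frame_ne_zero he (hmem q.1 hq.1)).neg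

theorem IsSemiFlat.potential_eq (hψ : IsSemiFlat g U r r' ψ) (hr' : 0 < r') {t : ℝ}
    (he : IsGraphical (h t) ψ e) {z : Cn n} (hz : z ∈ tube n r r') :
    (h t).potential ψ e z = basePotential h ψ e (xPart z, t) := by
  have htar := hψ.target_eq_tube
  have hs := (h t).smooth ψ hψ.mem_atlas ψ.source e ψ.open_source he.frame
  have hlog : DifferentiableOn ℝ
      (fun w => Real.log ((h t).form (ψ.symm w) (e (ψ.symm w)) (e (ψ.symm w))).re)
      (tube n r r') := by
    rw [← htar]
    have hs' := hs.mono (s := ψ.target ∩ ψ.symm ⁻¹' ψ.source) (t := ψ.target)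
      fun w hw => ⟨hw, ψ.map_target hw⟩
    exact (hs'.log fun w hw => (h t).form_frame_ne_zero he.frame hw).differentiableOn (by simp)
  have h1 := eq_mkC_zero_of_dY_eq_zero hr' hψ.isOpen_tube hlog
    (fun w hw k => he.log_y w (htar ▸ hw) k) hz
  exact congrArg Neg.neg h1

end Potential

/-! ### Derivatives of the potential after subtracting its Taylor polynomial. -/

section Translate

variable {n : ℕ} {r r' a b T' t : ℝ} {φ : Cn n → ℝ → ℝ} {φ0 : Rn n × ℝ → ℝ} {z₀ z : Cn n}

theorem hasFDerivAt_slice {F : Rn n × ℝ → ℝ} (hF : ContDiffOn ℝ ∞ F (Metric.ball 0 r ×ˢ Ioo a b))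
    {x : Rn n} (hx : x ∈ Metric.ball (0 : Rn n) r) (ht : t ∈ Ioo a b) :
    HasFDerivAt (fun x => F (x, t))
      ((fderiv ℝ F (x, t)).comp (ContinuousLinearMap.inl ℝ (Rn n) ℝ)) x := by
  have hW : IsOpen (Metric.ball (0 : Rn n) r ×ˢ Ioo a b) := Metric.isOpen_ball.prod isOpen_Ioo
  have hmem : (x, t) ∈ Metric.ball (0 : Rn n) r ×ˢ Ioo a b := ⟨hx, ht⟩
  have hd : HasFDerivAt F (fderiv ℝ F (x, t)) (x, t) :=
    ((hF.contDiffAt (hW.mem_nhds hmem)).differentiableAt (by simp)).hasFDerivAt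
  exact hd.comp x (hasFDerivAt_prodMk_left x t)

theorem dX_eq_slopeX (hopen : IsOpen (tube n r r'))
    (hφ0 : ContDiffOn ℝ ∞ φ0 (Metric.ball 0 r ×ˢ Ioo a b))
    (hφ : ∀ t ∈ Ioo a b, ∀ z ∈ tube n r r', φ z t = φ0 (xPart z, t)) (ht : t ∈ Ioo a b)
    (hz : z ∈ tube n r r') (k : Fin n) :
    dX k (fun w => φ w t) z = slopeX φ0 k (xPart z, t) := by
  have he : (fun w => φ w t) =ᶠ[𝓝 z] fun w => φ0 (xPart w, t) := by
    filter_upwards [hopen.mem_nhds hz] with w hw using hφ t ht w hw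
  exact (dX_dY_comp_xPart (A := fun x => φ0 (x, t)) he (hasFDerivAt_slice hφ0 hz.1 ht) k).1

/-- `translate` in the real coordinates of the base. -/
def baseTranslate (φ0 : Rn n × ℝ → ℝ) (x0 : Rn n) (T' t : ℝ) (x : Rn n) : ℝ :=
  φ0 (x, t) - (φ0 (x0, T') + ∑ i, slopeX φ0 i (x0, T') * (x i - x0 i))

theorem translate_eq (hopen : IsOpen (tube n r r'))
    (hφ0 : ContDiffOn ℝ ∞ φ0 (Metric.ball 0 r ×ˢ Ioo a b))
    (hφ : ∀ t ∈ Ioo a b, ∀ z ∈ tube n r r', φ z t = φ0 (xPart z, t)) (ht : t ∈ Ioo a b)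
    (hT' : T' ∈ Ioo a b) (hz₀ : z₀ ∈ tube n r r') (hz : z ∈ tube n r r') :
    translate φ z₀ T' z t = baseTranslate φ0 (xPart z₀) T' t (xPart z) := by
  simp only [translate, baseTranslate, hφ t ht z hz, hφ T' hT' z₀ hz₀,
    dX_eq_slopeX hopen hφ0 hφ hT' hz₀]

/-- The derivative of `baseTranslate`. -/
def baseTranslateDeriv (φ0 : Rn n × ℝ → ℝ) (x0 : Rn n) (T' t : ℝ) (x : Rn n) : Rn n →L[ℝ] ℝ :=
  (fderiv ℝ φ0 (x, t)).comp (ContinuousLinearMap.inl ℝ (Rn n) ℝ) -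
    ∑ i, slopeX φ0 i (x0, T') • (EuclideanSpace.proj i : Rn n →L[ℝ] ℝ)

theorem hasFDerivAt_baseTranslate (hφ0 : ContDiffOn ℝ ∞ φ0 (Metric.ball 0 r ×ˢ Ioo a b))
    (ht : t ∈ Ioo a b) (x0 : Rn n) {x : Rn n} (hx : x ∈ Metric.ball (0 : Rn n) r) :
    HasFDerivAt (baseTranslate φ0 x0 T' t) (baseTranslateDeriv φ0 x0 T' t x) x := by
  have hlin : HasFDerivAt (fun x : Rn n => φ0 (x0, T') + ∑ i, slopeX φ0 i (x0, T') * (x i - x0 i))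
      (∑ i, slopeX φ0 i (x0, T') • (EuclideanSpace.proj i : Rn n →L[ℝ] ℝ)) x := by
    refine HasFDerivAt.const_add _ (HasFDerivAt.fun_sum fun i _ => ?_)
    exact (((EuclideanSpace.proj i : Rn n →L[ℝ] ℝ).hasFDerivAt).sub_const (x0 i)).const_mul _
  exact (hasFDerivAt_slice hφ0 hx ht).sub hlin

theorem baseTranslateDeriv_single (x0 x : Rn n) (k : Fin n) :
    baseTranslateDeriv φ0 x0 T' t x (EuclideanSpace.single k 1) =
      slopeX φ0 k (x, t) - slopeX φ0 k (x0, T') := by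
  simp [baseTranslateDeriv, slopeX]

/-- The affine correction has constant slope, so the gradient vanishes at $(x_0,T')$. Without this
the rescaled position norm would have no finite limit in general. -/
theorem dX_translate (hopen : IsOpen (tube n r r'))
    (hφ0 : ContDiffOn ℝ ∞ φ0 (Metric.ball 0 r ×ˢ Ioo a b))
    (hφ : ∀ t ∈ Ioo a b, ∀ z ∈ tube n r r', φ z t = φ0 (xPart z, t)) (ht : t ∈ Ioo a b)
    (hT' : T' ∈ Ioo a b) (hz₀ : z₀ ∈ tube n r r') (hz : z ∈ tube n r r') (k : Fin n) :
    dX k (fun w => translate φ z₀ T' w t) z =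
      slopeX φ0 k (xPart z, t) - slopeX φ0 k (xPart z₀, T') := by
  have he : (fun w => translate φ z₀ T' w t) =ᶠ[𝓝 z]
      fun w => baseTranslate φ0 (xPart z₀) T' t (xPart w) := by
    filter_upwards [hopen.mem_nhds hz] with w hw using
      translate_eq hopen hφ0 hφ ht hT' hz₀ hw
  rw [(dX_dY_comp_xPart he (hasFDerivAt_baseTranslate hφ0 ht (xPart z₀) hz.1) k).1,
    baseTranslateDeriv_single]

/-- An affine function has zero Hessian, so the translation does not change the curvature. -/
theorem curv_translate (hopen : IsOpen (tube n r r'))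
    (hφ0 : ContDiffOn ℝ ∞ φ0 (Metric.ball 0 r ×ˢ Ioo a b))
    (hφ : ∀ t ∈ Ioo a b, ∀ z ∈ tube n r r', φ z t = φ0 (xPart z, t)) (ht : t ∈ Ioo a b)
    (hT' : T' ∈ Ioo a b) (hz₀ : z₀ ∈ tube n r r') (hz : z ∈ tube n r r') :
    curv (fun w => translate φ z₀ T' w t) z =
      ((1 / 4 : ℝ) • hessX φ0 (xPart z, t)).map Complex.ofReal := by
  have hW : IsOpen (Metric.ball (0 : Rn n) r ×ˢ Ioo a b) := Metric.isOpen_ball.prod isOpen_Ioo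
  have hB : ∀ k : Fin n, HasFDerivAt
      (fun x => baseTranslateDeriv φ0 (xPart z₀) T' t x (EuclideanSpace.single k 1))
      ((fderiv ℝ (slopeX φ0 k) (xPart z, t)).comp (ContinuousLinearMap.inl ℝ (Rn n) ℝ))
      (xPart z) := by
    intro k
    simp only [baseTranslateDeriv_single]
    exact (hasFDerivAt_slice (contDiffOn_slopeX hW hφ0 k) hz.1 ht).sub_const _
  rw [curv_comp_xPart hopen hz (fun w hw => translate_eq hopen hφ0 hφ ht hT' hz₀ hw)
    (fun w hw => hasFDerivAt_baseTranslate hφ0 ht (xPart z₀) hw.1) hB]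
  rfl

end Translate

/-! ### Reduction to the base and evaluation of the density. -/

section Theta

variable {n : ℕ} {X : Type*} [TopologicalSpace X] [ChartedSpace (Cn n) X]
  {g : KahlerMetric n X} {U : Set X} {r r' a b T' t : ℝ} {ψ : OpenPartialHomeomorph X (Cn n)}
  {φ : Cn n → ℝ → ℝ} {φ0 : Rn n × ℝ → ℝ} {z₀ : Cn n}

theorem posNorm_translate (hψ : IsSemiFlat g U r r' ψ) (hr' : 0 < r')
    (hφ0 : ContDiffOn ℝ ∞ φ0 (Metric.ball 0 r ×ˢ Ioo a b))
    (hφ : ∀ t ∈ Ioo a b, ∀ z ∈ tube n r r', φ z t = φ0 (xPart z, t)) (ht : t ∈ Ioo a b)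
    (hT' : T' ∈ Ioo a b) (hz₀ : z₀ ∈ tube n r r') {z : Cn n} (hz : z ∈ tube n r r') :
    posNorm (g.mat ψ z) (fun w => translate φ z₀ T' w t) z₀ z =
      posNormX (baseMat g ψ) φ0 (xPart z₀) T' (xPart z) t := by
  rw [posNorm, hψ.mat_eq hr' hz, sectionNormSq_ofReal, posNormX]
  simp only [dX_translate hψ.isOpen_tube hφ0 hφ ht hT' hz₀ hz]

/-- Fubini over the fibres of a semi-flat chart. -/
theorem Theta_translate (hψ : IsSemiFlat g U r r' ψ) (hr' : 0 < r') (hlam : 0 < lam g ψ)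
    (hφ0 : ContDiffOn ℝ ∞ φ0 (Metric.ball 0 r ×ˢ Ioo a b))
    (hφ : ∀ t ∈ Ioo a b, ∀ z ∈ tube n r r', φ z t = φ0 (xPart z, t)) (ht : t ∈ Ioo a b)
    (hT' : T' ∈ Ioo a b) (hz₀ : z₀ ∈ tube n r r') (f : ℝ → ℝ) :
    Theta g ψ r r' f (translate φ z₀ T') z₀ T' t =
      (∫ x in Metric.ball (0 : Rn n) r,
        (1 / (4 * Real.pi * (T' - t)) ^ ((n : ℝ) / 2)) *
          Real.exp (-(posNormX (baseMat g ψ) φ0 (xPart z₀) T' x t) ^ 2 / (4 * (T' - t))) *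
          f (4 * posNormX (baseMat g ψ) φ0 (xPart z₀) T' x t / (lam g ψ * r)) *
          densityX (baseMat g ψ) φ0 x t) * volume.real (Metric.ball (0 : Rn n) r') := by
  have hball : ∫ _ in Metric.ball (0 : Rn n) r', (1 : ℝ) =
      volume.real (Metric.ball (0 : Rn n) r') := by
    rw [setIntegral_const, smul_eq_mul, mul_one]
  -- The fibre factor is written as the integral of $1$, so that the right side becomes an integral
  -- over the product of the balls.
  rw [← hball, ← setIntegral_prod_mul, ← Measure.volume_eq_prod, Theta]
  refine setIntegral_congr_fun
    (Metric.isOpen_ball.measurableSet.prod Metric.isOpen_ball.measurableSet) fun q hq => ?_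
  have hz : mkC q.1 q.2 ∈ tube n r r' := mkC_mem_tube hq.1 hq.2
  have hpos := hψ.posDef_baseMat hr' hlam hq.1
  have hP := posNorm_translate hψ hr' hφ0 hφ ht hT' hz₀ hz
  simp only [hP]
  simp only [curv_translate hψ.isOpen_tube hφ0 hφ ht hT' hz₀ hz, hψ.mat_eq hr' hz, xPart_mkC,
    muDensity_eq hpos, densityX, mul_one]

end Theta

section Density

variable {n : ℕ} {X : Type*} [TopologicalSpace X] [ChartedSpace (Cn n) X]
  {L : X → Type*} [TopologicalSpace (TotalSpace ℂ L)]
  [∀ x, AddCommGroup (L x)] [∀ x, Module ℂ (L x)] [∀ x, TopologicalSpace (L x)]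
  [FiberBundle ℂ L]
  {g : KahlerMetric n X} {U : Set X} {r r' T' : ℝ} {ψ : OpenPartialHomeomorph X (Cn n)}
  {T : EReal} {h : ℝ → HermitianMetric n L} {e : ∀ x, L x}

/-- At every point of space-time where the flow is smooth, the Gaussian density equals `1`. -/
theorem tendsto_gaussianDensity (hflow : IsLineBundleMCF g h T) (hr : 0 < r) (hr' : 0 < r')
    (hψ : IsSemiFlat g U r r' ψ) (he : ∀ t ∈ timeSet T, IsGraphical (h t) ψ e)
    (hlam : 0 < lam g ψ) {f : ℝ → ℝ} (hf : IsCutoff f) {p : X} (hp : p ∈ U)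
    (hpr : xPart (ψ p) ∈ Metric.ball (0 : Rn n) (r / 4)) (hT'0 : 0 < T')
    (hT'T : (T' : EReal) < T) :
    Tendsto (fun t => gaussianDensity g ψ r r' f e h p T' t) (𝓝[<] T') (𝓝 1) := by
  -- A real $b$ between $T'$ and $T$, which may be $\infty$, gives an open time interval $(0,b)$
  -- around $T'$ inside the flow.
  obtain ⟨b, hTb, hbT⟩ := EReal.lt_iff_exists_real_btwn.1 hT'T
  have hTb : T' < b := EReal.coe_lt_coe_iff.1 hTb
  have hT' : T' ∈ Ioo 0 b := ⟨hT'0, hTb⟩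
  have hI : Ioo 0 b ⊆ timeSet T := fun t ht =>
    ⟨ht.1.le, (EReal.coe_lt_coe_iff.2 ht.2).trans hbT⟩
  have hz₀ : ψ p ∈ tube n r r' := hψ.target_eq_tube ▸ ψ.map_source (hψ.source_eq ▸ hp)
  have hφ0 : ContDiffOn ℝ ∞ (basePotential h ψ e) (Metric.ball 0 r ×ˢ Ioo 0 b) :=
    hψ.contDiffOn_basePotential hr' hflow (he T' (hI hT')).frame hI
  have hφ : ∀ t ∈ Ioo 0 b, ∀ z ∈ tube n r r',
      (fun z s => (h s).potential ψ e z) z t = basePotential h ψ e (xPart z, t) :=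
    fun t ht z hz => hψ.potential_eq hr' (he t (hI ht)) hz
  have hlim := tendsto_base_integral hlam hr hpr hT' hf (hψ.continuousOn_baseMat hr')
    (fun x hx => hψ.posDef_baseMat hr' hlam hx) (fun x hx => hψ.lam_sq_le hr' hlam hx) hφ0
  have hlim' := (hlim.mul_const (volume.real (Metric.ball (0 : Rn n) r'))).const_mul
    ((2 * √2) ^ n / fibreVol g ψ r' (ψ p))
  have hvol : 0 < volume.real (Metric.ball (0 : Rn n) r') :=
    ENNReal.toReal_pos (Metric.measure_ball_pos volume _ hr').ne' measure_ball_lt_top.ne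
  have hdet := Real.sqrt_pos.2 (hψ.posDef_baseMat hr' hlam hz₀.1).det_pos
  -- The prefactor splits as $2^n\cdot\sqrt2^{\,n}$: the first cancels the $2^{-n}$ of the Gaussian
  -- limit, the second the $\sqrt2^{\,n}$ of the fibre volume.
  have hone : (2 * √2) ^ n / fibreVol g ψ r' (ψ p) *
      (√(baseMat g ψ (xPart (ψ p))).det / 2 ^ n * volume.real (Metric.ball (0 : Rn n) r')) = 1 := by
    rw [hψ.fibreVol_eq hr' hz₀.1, mul_pow]
    have : 0 < √(2 : ℝ) := by positivity
    field_simp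
  rw [hone] at hlim'
  refine hlim'.congr' ?_
  filter_upwards [Ioo_mem_nhdsLT hT'0] with t ht
  rw [gaussianDensity, Theta_translate hψ hr' hlam hφ0 hφ ⟨ht.1, ht.2.trans hTb⟩ hT' hz₀ f]

end Density

end LBMCF

end

theorem mainTheorem4 {n : ℕ} (hn : 1 ≤ n)
    {X : Type*} [TopologicalSpace X] [T2Space X] [SecondCountableTopology X]
    [ChartedSpace (LBMCF.Cn n) X] [IsManifold 𝓘(ℂ, LBMCF.Cn n) ω X]
    {L : X → Type*} [TopologicalSpace (TotalSpace ℂ L)]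
    [∀ x, AddCommGroup (L x)] [∀ x, Module ℂ (L x)] [∀ x, TopologicalSpace (L x)]
    [FiberBundle ℂ L] [VectorBundle ℂ ℂ L] [ContMDiffVectorBundle ω ℂ L 𝓘(ℂ, LBMCF.Cn n)]
    (g : LBMCF.KahlerMetric n X)
    (T : EReal) (h : ℝ → LBMCF.HermitianMetric n L) (hflow : LBMCF.IsLineBundleMCF g h T)
    (U : Set X) (r r' : ℝ) (hr : 0 < r) (hr' : 0 < r')
    (ψ : OpenPartialHomeomorph X (LBMCF.Cn n)) (hψ : LBMCF.IsSemiFlat g U r r' ψ)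
    (e : ∀ x, L x) (he : ∀ t ∈ LBMCF.timeSet T, LBMCF.IsGraphical (h t) ψ e)
    (hlam : 0 < LBMCF.lam g ψ)
    (f : ℝ → ℝ) (hf : LBMCF.IsCutoff f)
    (p : X) (hp : p ∈ U) (hpr : LBMCF.xPart (ψ p) ∈ Metric.ball (0 : LBMCF.Rn n) (r / 4))
    (T' : ℝ) (hT'0 : 0 < T') (hT'T : (T' : EReal) < T) :
    ∃ Θ₀ : ℝ,
      Tendsto (fun t => LBMCF.gaussianDensity g ψ r r' f e h p T' t) (𝓝[<] T') (𝓝 Θ₀) ∧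
        1 ≤ Θ₀ :=
  ⟨1, LBMCF.tendsto_gaussianDensity hflow hr hr' hψ he hlam hf hp hpr hT'0 hT'T, le_rfl⟩
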